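/- Let $m\ge 1$ be an integer, $p=m+1$, and let $\sigma_1,\dots,\sigma_m>-1$ be real. Put $\mu_k=\prod_{j=1}^m(\sigma_j+k)^{-1}$ and $\gamma_k=\mu_k/\mu_1$, and let $$F(x)={}_0F_m\big(-;\sigma_1+1,\dots,\sigma_m+1;-(x/p)^p\big)=\sum_{k=0}^\infty\frac{1}{(\sigma_1+1)_k\cdots(\sigma_m+1)_k}\,\frac{(-1)^k(x/p)^{kp}}{k!}.$$ Then $F$ has a first positive zero $j_{\vec\sigma,1}$. For real $n>0$ let ${\cal J}_n=\int_0^{j_{\vec\sigma,1}}F(x)^n\,dx$. There is a real sequence $(A_k)_{k\ge0}$, the coefficients in the expansion $$\frac{dx}{d\tau}=\frac{p}{\mu_1^{1/p}}\sum_{k=0}^\infty\frac{(-1)^kA_k}{p^k}\,(kp+1)\,\tau^{kp},$$ valid for all sufficiently small $\tau>0$, of the derivative of the inverse function $\tau\mapsto x$ of $\tau=(-\log F(x))^{1/p}$, $0<x<j_{\vec\sigma,1}$, such that, as $n\to\infty$, $${\cal J}_n\sim\frac{p}{(n\mu_1)^{1/p}}\sum_{k=0}^\infty\frac{(-1)^kA_k}{(np)^k}\,\Gamma\Big(k+\frac1p+1\Big),$$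 that is, for every integer $N\ge 0$, $${\cal J}_n-\frac{p}{(n\mu_1)^{1/p}}\sum_{k=0}^{N-1}\frac{(-1)^kA_k}{(np)^k}\,\Gamma\Big(k+\frac1p+1\Big)=O\big(n^{-N-1/p}\big).$$ The first five coefficients are $$A_0=1,\qquad A_1=\tfrac12(1-\gamma_2),\qquad A_2=\tfrac1{24}\big\{p+3-6(p+1)\gamma_2+3(3p+1)\gamma_2^2-4p\gamma_2\gamma_3\big\},$$ $$A_3=\tfrac1{48}\big\{p+1-(p+1)(4p+3)\gamma_2+3(2p+1)(3p+1)\gamma_2^2-4p(2p+1)\gamma_2\gamma_3-\gamma_2\big((1+9p+20p^2)\gamma_2^2-4p(4p+1)\gamma_2\gamma_3+2p^2\gamma_3\gamma_4\big)\big\},$$ $$\begin{aligned}A_4=\tfrac1{5760}\big\{&15+30p+5p^2-2p^3-60(p+1)^2(2p+1)\gamma_2+10(3+13p+14p^2)\gamma_2\big(3(3p+1)\gamma_2-4p\gamma_3\big)\\&-60(3p+1)\gamma_2\big((1+9p+20p^2)\gamma_2^2-4p(4p+1)\gamma_2\gamma_3+2p^2\gamma_3\gamma_4\big)\\&+\gamma_2\big(15(1+18p+107p^2+210p^3)\gamma_2^3-120p(1+11p+30p^2)\gamma_2^2\gamma_3\\&\qquad+40p^2(5p+1)\gamma_2\gamma_3(2\gamma_3+3\gamma_4)-48p^3\gamma_3\gamma_4\gamma_5\big)\big\}.\end{aligned}$$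 -/

import Mathlib

open Filter Asymptotics

noncomputable section

/-- The generalised hypergeometric function `₀F_m(-; b₁, …, b_m; z)` of a real variable, with
`m` denominator parameters: `∑ k, z ^ k / ((b₁)_k ⋯ (b_m)_k k!)`. -/
def hypergeometricZeroF {m : ℕ} (b : Fin m → ℝ) (z : ℝ) : ℝ :=
  ∑' k : ℕ, z ^ k / ((∏ j, (ascPochhammer ℝ k).eval (b j)) * (k.factorial : ℝ))

/-- The normalised hyper-Bessel function
`x ↦ ₀F_m(-; σ₁ + 1, …, σ_m + 1; -(x / (m + 1)) ^ (m + 1))`. -/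
def normHyperBessel {m : ℕ} (σ : Fin m → ℝ) (x : ℝ) : ℝ :=
  hypergeometricZeroF (fun j => σ j + 1) (-(x / ((m : ℝ) + 1)) ^ (m + 1))

/-- The first positive zero of the (normalised) hyper-Bessel function. -/
def hyperBesselFirstZero {m : ℕ} (σ : Fin m → ℝ) : ℝ :=
  sInf {x : ℝ | 0 < x ∧ normHyperBessel σ x = 0}

/-- The integral over `[0, j]`, with `j` the first positive zero, of the `n`-th power of the
normalised hyper-Bessel function; `n` is real (the base is nonnegative on `[0, j]`). -/
def hyperBesselIntegral {m : ℕ} (σ : Fin m → ℝ) (n : ℝ) : ℝ :=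
  ∫ x in (0 : ℝ)..hyperBesselFirstZero σ, normHyperBessel σ x ^ n

/-- `μ_k = ∏ j, (σ_j + k)⁻¹`. -/
def hyperMu {m : ℕ} (σ : Fin m → ℝ) (k : ℕ) : ℝ :=
  ∏ j, (σ j + (k : ℝ))⁻¹

/-- `γ_k = μ_k / μ_1`. -/
def hyperGamma {m : ℕ} (σ : Fin m → ℝ) (k : ℕ) : ℝ :=
  hyperMu σ k / hyperMu σ 1

/-- The new variable `τ`, defined by `τ ^ (m + 1) = ψ(x)`, where `ψ = -log` of the normalised
hyper-Bessel function (for `x` between `0` and the first positive zero). -/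
def hyperTau {m : ℕ} (σ : Fin m → ℝ) (x : ℝ) : ℝ :=
  (-Real.log (normHyperBessel σ x)) ^ (1 / ((m : ℝ) + 1))

/-- `x` as a function of `τ`: the inverse of `hyperTau σ` on the interval from `0` to the first
positive zero. -/
def hyperX {m : ℕ} (σ : Fin m → ℝ) : ℝ → ℝ :=
  Function.invFunOn (hyperTau σ) (Set.Ioo 0 (hyperBesselFirstZero σ))

/-- `A` is the sequence of coefficients in the expansion
`dx/dτ = (p / μ₁ ^ (1 / p)) ∑ k, ((-1) ^ k A_k / p ^ k) (k p + 1) τ ^ (k p)`, `p = m + 1`,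
valid for all sufficiently small `τ > 0`. -/
def IsHyperCoeff {m : ℕ} (σ : Fin m → ℝ) (A : ℕ → ℝ) : Prop :=
  ∃ τ₀ : ℝ, 0 < τ₀ ∧ ∀ τ ∈ Set.Ioo 0 τ₀, ∃ D : ℝ, HasDerivAt (hyperX σ) D τ ∧
    HasSum (fun k : ℕ => ((m : ℝ) + 1) / hyperMu σ 1 ^ (1 / ((m : ℝ) + 1)) *
      ((-1) ^ k * A k / ((m : ℝ) + 1) ^ k * ((k : ℝ) * ((m : ℝ) + 1) + 1) *
        τ ^ (k * (m + 1)))) D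

end

/-! Put `p = m + 1` and `y = (x/p)^p`, so that `F(x) = f(y)` with `f` entire and `f'(0) = -μ₁`.

Zeros and monotonicity. The `n`-th coefficient of `-f'` is that of `f` divided by `∏ j, (n + σ_j +
1)`. Dividing by one factor at a time gives functions `u_S` from `u_∅ = f` to `u_univ = -f'`, linked
by `y u' + (σ_k + 1) u = u_S` for `u = u_{S ∪ {k}}`, that is, `(y^(σ_k+1) u)' = y^σ_k u_S`. Since
`σ_k + 1 > 0`, positivity of `f` on `(0, Y)` passes along the chain to `-f'`, so `F` decreases
strictly up to its first zero. The same induction gives `-f' ≥ μ₁ f`. If `f` had no positive zero,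
this would force `f ≤ exp(-μ₁ y)`, whereas the last link of the chain keeps `-f'`, hence `f`, above
a constant times a negative power of `y + 1`; these are incompatible (`exists_hyperSeries_eq_zero`).

Asymptotics. Near `0`, `s = -log f(y)` has the analytic inverse `y = s k(s)/μ₁` with `k(0) = 1`. Let
`h` be the analytic `p`-th root of `k`. With `s = τ^p` this reads `x = p μ₁^(-1/p) τ h(τ^p)`, whence
`dx/dτ = p μ₁^(-1/p) (h + p s h')(τ^p)` and `A_k = (-p)^k h_k`, where `h_k` are the Taylor
coefficients of `h`. The substitution turns the integral near `0` into `∫ exp(-n τ^p) (dx/dτ) dτ`,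
to which Watson's lemma applies (`watson_bound`); by monotonicity of `F` the rest is exponentially
small.

Coefficients. Comparing Taylor coefficients in `f(s k/μ₁) = exp(-s)` determines those of `k`, and `p
h' k = h k'` then determines those of `h`. -/

/-! ### Real power series: summability and termwise differentiation. -/

open Topology in
/-- Termwise differentiation of a power series in one real variable. -/
theorem HasFPowerSeriesOnBall.hasSum_deriv_real {f : ℝ → ℝ} {a : ℕ → ℝ} {r : ENNReal}
    (hf : HasFPowerSeriesOnBall f (FormalMultilinearSeries.ofScalars ℝ a) 0 r) {y : ℝ}
    (hy : y ∈ Metric.eball (0 : ℝ) r) :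
    HasSum (fun n : ℕ => ((n : ℝ) + 1) * a (n + 1) * y ^ n) (deriv f y) := by
  have h := (hf.fderiv).hasSum hy
  rw [zero_add] at h
  have h1 := (ContinuousLinearMap.apply ℝ ℝ (1 : ℝ)).hasSum h
  convert! h1 using 1
  funext n
  have h2 := (FormalMultilinearSeries.ofScalars ℝ a).derivSeries_coeff_one n
  rw [FormalMultilinearSeries.coeff_ofScalars] at h2
  simp only [FormalMultilinearSeries.apply_eq_pow_smul_coeff, ContinuousLinearMap.apply_apply,
    smul_apply, h2]
  simp
  ring

theorem hasFPowerSeriesOnBall_of_summable {a : ℕ → ℝ}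
    (ha : ∀ y : ℝ, Summable fun n => a n * y ^ n) :
    HasFPowerSeriesOnBall (fun y => ∑' n, a n * y ^ n)
      (FormalMultilinearSeries.ofScalars ℝ a) 0 ⊤ := by
  have hr : (FormalMultilinearSeries.ofScalars ℝ a).radius = ⊤ := by
    refine FormalMultilinearSeries.radius_eq_top_of_summable_norm _ fun r => ?_
    refine (ha r).norm.congr fun n => ?_
    rw [FormalMultilinearSeries.ofScalars_norm]
    simp
  have h := (FormalMultilinearSeries.ofScalars ℝ a).hasFPowerSeriesOnBall (by rw [hr]; simp)
  rw [hr] at h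
  refine h.congr fun y _ => ?_
  simp only [FormalMultilinearSeries.sum, FormalMultilinearSeries.ofScalars_apply_eq, smul_eq_mul]

theorem hasDerivAt_tsum_mul_pow {a : ℕ → ℝ} (ha : ∀ y : ℝ, Summable fun n => a n * y ^ n)
    (y : ℝ) :
    HasDerivAt (fun y => ∑' n, a n * y ^ n) (∑' n : ℕ, ((n : ℝ) + 1) * a (n + 1) * y ^ n) y := by
  have h := hasFPowerSeriesOnBall_of_summable ha
  have hy : y ∈ Metric.eball (0 : ℝ) ⊤ := by simp
  rw [(h.hasSum_deriv_real hy).tsum_eq]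
  exact (h.analyticAt_of_mem hy).differentiableAt.hasDerivAt

theorem summable_succ_mul_pow {a : ℕ → ℝ} (ha : ∀ y : ℝ, Summable fun n => a n * y ^ n) (y : ℝ) :
    Summable fun n : ℕ => ((n : ℝ) + 1) * a (n + 1) * y ^ n :=
  ((hasFPowerSeriesOnBall_of_summable ha).hasSum_deriv_real (by simp)).summable

/-- Iterating the hypothesis gives `|a n| ≤ |a 0| M^n / n!`, so the series is dominated by an
exponential one. -/
theorem summable_mul_pow_of_succ_le {a : ℕ → ℝ} {M : ℝ} (hM : 0 ≤ M)
    (h : ∀ n : ℕ, ((n : ℝ) + 1) * |a (n + 1)| ≤ M * |a n|) (y : ℝ) :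
    Summable fun n => a n * y ^ n := by
  have hb : ∀ n : ℕ, |a n| ≤ |a 0| * (M ^ n / (n.factorial : ℝ)) := by
    intro n
    induction n with
    | zero => simp
    | succ n ih =>
      have hn : (0 : ℝ) < (n : ℝ) + 1 := by positivity
      have h1 := (h n).trans (mul_le_mul_of_nonneg_left ih hM)
      rw [← le_div_iff₀' hn] at h1
      refine h1.trans_eq ?_
      rw [Nat.factorial_succ]
      push_cast
      field_simp
      ring
  refine Summable.of_norm_bounded
    (((Real.summable_pow_div_factorial (M * |y|)).mul_left |a 0|)) fun n => ?_
  rw [Real.norm_eq_abs, abs_mul, abs_pow, mul_pow]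
  calc |a n| * |y| ^ n ≤ |a 0| * (M ^ n / (n.factorial : ℝ)) * |y| ^ n := by
        gcongr; exact hb n
    _ = _ := by ring

/-! ### The chain of entire functions from `f` to `-f'`. -/

/-- Coefficients of `₀F_m(-; σ + 1; -y)` with the `n`-th one divided by `∏ j ∈ S, (σ j + n + 1)`. -/
noncomputable def hyperCoeff {m : ℕ} (σ : Fin m → ℝ) (S : Finset (Fin m)) (n : ℕ) : ℝ :=
  (-1) ^ n / ((∏ j, (ascPochhammer ℝ n).eval (σ j + 1)) * (n.factorial : ℝ) *
    ∏ j ∈ S, ((n : ℝ) + (σ j + 1)))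

/-- The entire functions interpolating between `₀F_m(-; σ + 1; -y)` (for `S = ∅`) and minus its
derivative (for `S = univ`). -/
noncomputable def hyperSeries {m : ℕ} (σ : Fin m → ℝ) (S : Finset (Fin m)) (y : ℝ) : ℝ :=
  ∑' n, hyperCoeff σ S n * y ^ n

section
variable {m : ℕ} {σ : Fin m → ℝ}

theorem hyperMu_pos (hσ : ∀ j, -1 < σ j) {k : ℕ} (hk : 1 ≤ k) : 0 < hyperMu σ k := by
  refine Finset.prod_pos fun j _ => inv_pos.2 ?_
  have : (1 : ℝ) ≤ k := by exact_mod_cast hk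
  linarith [hσ j]

theorem prod_ascPochhammer_pos (hσ : ∀ j, -1 < σ j) (n : ℕ) :
    0 < ∏ j, (ascPochhammer ℝ n).eval (σ j + 1) :=
  Finset.prod_pos fun j _ => ascPochhammer_pos n _ (by linarith [hσ j])

theorem prod_natCast_add_pos (hσ : ∀ j, -1 < σ j) (S : Finset (Fin m)) (n : ℕ) :
    0 < ∏ j ∈ S, ((n : ℝ) + (σ j + 1)) :=
  Finset.prod_pos fun j _ => by
    have : (0 : ℝ) ≤ n := n.cast_nonneg
    linarith [hσ j]

theorem prod_ascPochhammer_succ (n : ℕ) :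
    ∏ j, (ascPochhammer ℝ (n + 1)).eval (σ j + 1) =
      (∏ j, (ascPochhammer ℝ n).eval (σ j + 1)) * ∏ j, ((n : ℝ) + (σ j + 1)) := by
  rw [← Finset.prod_mul_distrib]
  exact Finset.prod_congr rfl fun j _ => by rw [ascPochhammer_succ_eval]; ring

theorem prod_natCast_add_eq_inv (n : ℕ) :
    ∏ j, ((n : ℝ) + (σ j + 1)) = (hyperMu σ (n + 1))⁻¹ := by
  rw [hyperMu, Finset.prod_inv_distrib, inv_inv]
  exact Finset.prod_congr rfl fun j _ => by push_cast; ring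

theorem hyperCoeff_empty_succ (hσ : ∀ j, -1 < σ j) (n : ℕ) :
    ((n : ℝ) + 1) * hyperCoeff σ ∅ (n + 1) = -hyperCoeff σ Finset.univ n := by
  have h1 := (prod_ascPochhammer_pos hσ n).ne'
  have h2 := (prod_natCast_add_pos hσ Finset.univ n).ne'
  have h3 : (n.factorial : ℝ) ≠ 0 := by positivity
  simp only [hyperCoeff, prod_ascPochhammer_succ, Finset.prod_empty, Nat.factorial_succ]
  push_cast
  field_simp
  ring

theorem hyperCoeff_univ (n : ℕ) :
    hyperCoeff σ Finset.univ n = hyperMu σ (n + 1) * hyperCoeff σ ∅ n := by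
  simp only [hyperCoeff, prod_natCast_add_eq_inv, Finset.prod_empty, mul_one]
  rw [← div_div, div_inv_eq_mul, mul_comm]

theorem hyperCoeff_insert (hσ : ∀ j, -1 < σ j) {S : Finset (Fin m)} {k : Fin m} (hk : k ∉ S)
    (n : ℕ) : ((n : ℝ) + (σ k + 1)) * hyperCoeff σ (insert k S) n = hyperCoeff σ S n := by
  have h1 := (prod_ascPochhammer_pos hσ n).ne'
  have h2 := (prod_natCast_add_pos hσ S n).ne'
  have h3 := (prod_natCast_add_pos hσ {k} n).ne'
  rw [Finset.prod_singleton] at h3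
  have h4 : (n.factorial : ℝ) ≠ 0 := by positivity
  simp only [hyperCoeff, Finset.prod_insert hk]
  field_simp

theorem abs_hyperCoeff (hσ : ∀ j, -1 < σ j) (S : Finset (Fin m)) (n : ℕ) :
    |hyperCoeff σ S n| = 1 / ((∏ j, (ascPochhammer ℝ n).eval (σ j + 1)) * (n.factorial : ℝ) *
      ∏ j ∈ S, ((n : ℝ) + (σ j + 1))) := by
  have h1 := prod_ascPochhammer_pos hσ n
  have h2 := prod_natCast_add_pos hσ S n
  rw [hyperCoeff, abs_div, abs_pow, abs_neg, abs_one, one_pow, abs_of_pos (by positivity)]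

/-- The products over `j` increase with `n`, so consecutive coefficients have ratio at most `μ₁ / (n
+ 1)` in absolute value. -/
theorem summable_hyperCoeff (hσ : ∀ j, -1 < σ j) (S : Finset (Fin m)) (y : ℝ) :
    Summable fun n => hyperCoeff σ S n * y ^ n := by
  refine summable_mul_pow_of_succ_le (hyperMu_pos hσ le_rfl).le (fun n => ?_) y
  have h1 := prod_ascPochhammer_pos hσ n
  have h2 := prod_natCast_add_pos hσ S n
  have h3 := prod_natCast_add_pos hσ Finset.univ n
  have h4 : ∏ j ∈ S, ((n : ℝ) + (σ j + 1)) ≤ ∏ j ∈ S, (((n + 1 : ℕ) : ℝ) + (σ j + 1)) := by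
    refine Finset.prod_le_prod (fun j _ => ?_) fun j _ => by push_cast; linarith
    have : (0 : ℝ) ≤ n := n.cast_nonneg
    linarith [hσ j]
  have h5 : (hyperMu σ 1)⁻¹ ≤ ∏ j, ((n : ℝ) + (σ j + 1)) := by
    have := prod_natCast_add_eq_inv (σ := σ) 0
    rw [zero_add] at this
    rw [← this]
    refine Finset.prod_le_prod (fun j _ => ?_) fun j _ => by simp
    simp; linarith [hσ j]
  have h6 : (0 : ℝ) < n.factorial := by positivity
  have hμ := inv_pos.2 (hyperMu_pos hσ le_rfl)
  rw [abs_hyperCoeff hσ, abs_hyperCoeff hσ, prod_ascPochhammer_succ, Nat.factorial_succ]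
  push_cast at h4 ⊢
  have h7 := h2.trans_le h4
  rw [mul_one_div, mul_one_div, ← inv_inv (hyperMu σ 1), inv_eq_one_div (hyperMu σ 1)⁻¹, div_div]
  rw [div_le_div_iff₀ (mul_pos (mul_pos (mul_pos h1 h3) (by positivity)) h7)
    (mul_pos hμ (mul_pos (mul_pos h1 h6) h2))]
  rw [one_mul]
  calc ((n : ℝ) + 1) * ((hyperMu σ 1)⁻¹ * ((∏ j, (ascPochhammer ℝ n).eval (σ j + 1)) *
        n.factorial * ∏ j ∈ S, ((n : ℝ) + (σ j + 1))))
      ≤ ((n : ℝ) + 1) * ((∏ j, ((n : ℝ) + (σ j + 1))) *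
        ((∏ j, (ascPochhammer ℝ n).eval (σ j + 1)) *
        n.factorial * ∏ j ∈ S, ((n : ℝ) + 1 + (σ j + 1)))) := by gcongr
    _ = _ := by ring

theorem hyperSeries_zero (S : Finset (Fin m)) : hyperSeries σ S 0 = hyperCoeff σ S 0 := by
  rw [hyperSeries, tsum_eq_single 0 fun n hn => by simp [hn]]
  simp

theorem hyperSeries_empty_zero : hyperSeries σ ∅ 0 = 1 := by
  rw [hyperSeries_zero]; simp [hyperCoeff]

theorem normHyperBessel_eq (x : ℝ) :
    normHyperBessel σ x = hyperSeries σ ∅ ((x / ((m : ℝ) + 1)) ^ (m + 1)) := by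
  rw [normHyperBessel, hypergeometricZeroF, hyperSeries]
  refine tsum_congr fun n => ?_
  rw [neg_pow]
  simp only [hyperCoeff, Finset.prod_empty]
  ring

theorem hasFPowerSeriesOnBall_hyperSeries (hσ : ∀ j, -1 < σ j) (S : Finset (Fin m)) :
    HasFPowerSeriesOnBall (hyperSeries σ S)
      (FormalMultilinearSeries.ofScalars ℝ (hyperCoeff σ S)) 0 ⊤ :=
  hasFPowerSeriesOnBall_of_summable (summable_hyperCoeff hσ S)

theorem differentiable_hyperSeries (hσ : ∀ j, -1 < σ j) (S : Finset (Fin m)) :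
    Differentiable ℝ (hyperSeries σ S) :=
  fun y => (hasDerivAt_tsum_mul_pow (summable_hyperCoeff hσ S) y).differentiableAt

theorem deriv_hyperSeries_empty (hσ : ∀ j, -1 < σ j) (y : ℝ) :
    deriv (hyperSeries σ ∅) y = -hyperSeries σ Finset.univ y := by
  refine ((hasDerivAt_tsum_mul_pow (summable_hyperCoeff hσ ∅) y).deriv).trans ?_
  rw [hyperSeries, ← tsum_neg]
  exact tsum_congr fun n => by rw [hyperCoeff_empty_succ hσ, neg_mul]

/-- The operator `y d/dy + (σ_k + 1)` multiplies the `n`-th coefficient by `n + σ_k + 1`, which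
cancels exactly the factor that inserting `k` put in the denominator. -/
theorem hyperSeries_ode (hσ : ∀ j, -1 < σ j) {S : Finset (Fin m)} {k : Fin m} (hk : k ∉ S)
    (y : ℝ) : y * deriv (hyperSeries σ (insert k S)) y +
      (σ k + 1) * hyperSeries σ (insert k S) y = hyperSeries σ S y := by
  have hs := summable_hyperCoeff hσ (insert k S)
  have hd : deriv (hyperSeries σ (insert k S)) y = _ := (hasDerivAt_tsum_mul_pow hs y).deriv
  have h1 : y * deriv (hyperSeries σ (insert k S)) y =
      ∑' n : ℕ, (n : ℝ) * hyperCoeff σ (insert k S) n * y ^ n := by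
    have h2 := (summable_succ_mul_pow hs y).mul_left y
    rw [hd, ← tsum_mul_left]
    have h3 : Summable fun n : ℕ => (n : ℝ) * hyperCoeff σ (insert k S) n * y ^ n := by
      rw [← summable_nat_add_iff 1]
      refine h2.congr fun n => ?_
      push_cast; ring
    rw [h3.tsum_eq_zero_add]
    simp only [Nat.cast_zero, zero_mul, zero_add]
    exact tsum_congr fun n => by push_cast; ring
  have h3 : Summable fun n : ℕ => (n : ℝ) * hyperCoeff σ (insert k S) n * y ^ n := by
    refine (((summable_hyperCoeff hσ S y).sub ((hs y).mul_left (σ k + 1)))).congr fun n => ?_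
    rw [← hyperCoeff_insert hσ hk]; ring
  rw [h1, hyperSeries, hyperSeries, ← tsum_mul_left, ← h3.tsum_add ((hs y).mul_left _)]
  exact tsum_congr fun n => by rw [← hyperCoeff_insert hσ hk]; ring

end

/-! ### Propagation of positivity and existence of a zero. -/

/-- If `y u' + (s + 1) u = v` with `s > -1`, then positivity of `v` on `(0, Y)` makes
`y ^ (s + 1) * u` strictly increasing there. -/
theorem strictMonoOn_rpow_mul {s : ℝ} (hs : -1 < s) {u : ℝ → ℝ} (hu : Differentiable ℝ u)
    {Y : ℝ} (hv : ∀ y ∈ Set.Ioo 0 Y, 0 < y * deriv u y + (s + 1) * u y) :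
    StrictMonoOn (fun y => y ^ (s + 1) * u y) (Set.Ico 0 Y) := by
  refine strictMonoOn_of_deriv_pos (convex_Ico 0 Y) ?_ fun y hy => ?_
  · exact ((Real.continuous_rpow_const (by linarith)).mul hu.continuous).continuousOn
  · rw [interior_Ico] at hy
    have h := (Real.hasDerivAt_rpow_const (p := s + 1) (Or.inl hy.1.ne')).mul (hu y).hasDerivAt
    have e : deriv (fun y => y ^ (s + 1) * u y) y = _ := h.deriv
    rw [e]
    have : (s + 1) * y ^ (s + 1 - 1) * u y + y ^ (s + 1) * deriv u y =
        y ^ s * (y * deriv u y + (s + 1) * u y) := by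
      rw [Real.rpow_add_one hy.1.ne', add_sub_cancel_right]; ring
    rw [this]
    exact mul_pos (Real.rpow_pos_of_pos hy.1 _) (hv y hy)

theorem monotoneOn_rpow_mul {s : ℝ} (hs : -1 < s) {u : ℝ → ℝ} (hu : Differentiable ℝ u)
    {Y : ℝ} (hv : ∀ y ∈ Set.Ioo 0 Y, 0 ≤ y * deriv u y + (s + 1) * u y) :
    MonotoneOn (fun y => y ^ (s + 1) * u y) (Set.Ico 0 Y) := by
  refine monotoneOn_of_deriv_nonneg (convex_Ico 0 Y) ?_ ?_ fun y hy => ?_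
  · exact ((Real.continuous_rpow_const (by linarith)).mul hu.continuous).continuousOn
  · intro y hy
    rw [interior_Ico] at hy
    exact ((Real.hasDerivAt_rpow_const (p := s + 1) (Or.inl hy.1.ne')).mul
      (hu y).hasDerivAt).differentiableAt.differentiableWithinAt
  · rw [interior_Ico] at hy
    have h := (Real.hasDerivAt_rpow_const (p := s + 1) (Or.inl hy.1.ne')).mul (hu y).hasDerivAt
    have e : deriv (fun y => y ^ (s + 1) * u y) y = _ := h.deriv
    rw [e]
    have : (s + 1) * y ^ (s + 1 - 1) * u y + y ^ (s + 1) * deriv u y =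
        y ^ s * (y * deriv u y + (s + 1) * u y) := by
      rw [Real.rpow_add_one hy.1.ne', add_sub_cancel_right]; ring
    rw [this]
    exact mul_nonneg (Real.rpow_pos_of_pos hy.1 _).le (hv y hy)

section
variable {m : ℕ} {σ : Fin m → ℝ}

/-- Induction along the chain: `y^(σ_k+1) u` vanishes at `0`, because `σ_k + 1 > 0`, and is strictly
increasing as long as the previous function is positive. -/
theorem hyperSeries_pos (hσ : ∀ j, -1 < σ j) {Y : ℝ}
    (hf : ∀ y ∈ Set.Ioo 0 Y, 0 < hyperSeries σ ∅ y) (S : Finset (Fin m)) :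
    ∀ y ∈ Set.Ioo 0 Y, 0 < hyperSeries σ S y := by
  induction S using Finset.induction_on with
  | empty => exact hf
  | insert k S hk ih =>
    intro y hy
    have h := strictMonoOn_rpow_mul (hσ k) (differentiable_hyperSeries hσ (insert k S)) (Y := Y)
      fun z hz => by rw [hyperSeries_ode hσ hk]; exact ih z hz
    have h0 := h ⟨le_rfl, hy.1.trans hy.2⟩ ⟨hy.1.le, hy.2⟩ hy.1
    have h1 : σ k + 1 ≠ 0 := by linarith [hσ k]
    simp only [Real.zero_rpow h1, zero_mul] at h0
    exact pos_of_mul_pos_right h0 (Real.rpow_nonneg hy.1.le _)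

/-- For `S = univ` this is the differential inequality `-f' ≥ μ₁ f`. In the induction the operator
`y d/dy + (σ_k + 1)`, applied to the difference of the two sides, yields the previous difference
plus a positive multiple of `-y f'`, which is nonnegative by `hyperSeries_pos`. -/
theorem hyperSeries_ge (hσ : ∀ j, -1 < σ j) {Y : ℝ}
    (hf : ∀ y ∈ Set.Ioo 0 Y, 0 < hyperSeries σ ∅ y) (S : Finset (Fin m)) :
    ∀ y ∈ Set.Ioo 0 Y, (∏ j ∈ S, (σ j + 1)⁻¹) * hyperSeries σ ∅ y ≤ hyperSeries σ S y := by
  induction S using Finset.induction_on with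
  | empty => simp
  | insert k S hk ih =>
    intro y hy
    have hk1 : 0 < σ k + 1 := by linarith [hσ k]
    set c := ∏ j ∈ S, (σ j + 1)⁻¹
    have hc : 0 < c := Finset.prod_pos fun j _ => inv_pos.2 (by linarith [hσ j])
    have hd := differentiable_hyperSeries hσ (insert k S)
    have hd0 := differentiable_hyperSeries hσ ∅
    have h := monotoneOn_rpow_mul (hσ k)
      (u := fun y => hyperSeries σ (insert k S) y - (σ k + 1)⁻¹ * c * hyperSeries σ ∅ y)
      (hd.sub (hd0.const_mul _)) (Y := Y) fun z hz => by
        have e : deriv (fun y => hyperSeries σ (insert k S) y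
            - (σ k + 1)⁻¹ * c * hyperSeries σ ∅ y) z = deriv (hyperSeries σ (insert k S)) z
              - (σ k + 1)⁻¹ * c * -hyperSeries σ Finset.univ z := by
          rw [← deriv_hyperSeries_empty hσ]
          exact ((hd z).hasDerivAt.sub ((hd0 z).hasDerivAt.const_mul _)).deriv
        have h1 := hyperSeries_ode hσ hk z
        have h2 := ih z hz
        have h3 := mul_pos hz.1 (hyperSeries_pos hσ hf Finset.univ z hz)
        have h4 : 0 ≤ (σ k + 1)⁻¹ * c * (z * hyperSeries σ Finset.univ z) := by positivity
        have h5 : (σ k + 1) * ((σ k + 1)⁻¹ * c * hyperSeries σ ∅ z) = c * hyperSeries σ ∅ z := by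
          field_simp
        rw [e]
        linarith
    have h0 := h ⟨le_rfl, hy.1.trans hy.2⟩ ⟨hy.1.le, hy.2⟩ hy.1.le
    simp only [Real.zero_rpow hk1.ne', zero_mul] at h0
    rw [Finset.prod_insert hk]
    exact sub_nonneg.1 (nonneg_of_mul_nonneg_right h0 (Real.rpow_pos_of_pos hy.1 _))

/-- A zero-free `f` would decay exponentially from above and at most polynomially from below. The
lower bound needs an index `k`, hence `m ≥ 1`; for `m = 0` the function is `exp(-y)`. -/
theorem exists_hyperSeries_eq_zero (hm : 1 ≤ m) (hσ : ∀ j, -1 < σ j) :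
    ∃ y, 0 < y ∧ hyperSeries σ ∅ y = 0 := by
  by_contra! hne
  set f := hyperSeries σ ∅ with hfdef
  have hd : Differentiable ℝ f := differentiable_hyperSeries hσ ∅
  have hpos : ∀ y, 0 < y → 0 < f y := by
    intro y hy
    by_contra! hle
    obtain ⟨z, hz, hz0⟩ := intermediate_value_Icc' hy.le hd.continuous.continuousOn
      (show (0 : ℝ) ∈ Set.Icc (f y) (f 0) from ⟨hle, by rw [hfdef, hyperSeries_empty_zero]; simp⟩)
    rcases hz.1.eq_or_lt with h | h
    · rw [← h, hfdef, hyperSeries_empty_zero] at hz0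
      exact one_ne_zero hz0
    · exact hne z h hz0
  have hf : ∀ Y, ∀ y ∈ Set.Ioo 0 Y, 0 < f y := fun Y y hy => hpos y hy.1
  set μ := ∏ j, (σ j + 1)⁻¹ with hμdef
  have hμ : 0 < μ := Finset.prod_pos fun j _ => inv_pos.2 (by linarith [hσ j])
  have hdf : ∀ y, deriv f y = -hyperSeries σ Finset.univ y := deriv_hyperSeries_empty hσ
  -- Since `-f' ≥ μ f`, the product `exp(μ y) f(y)` is nonincreasing from its value `1` at `0`.
  have hupper : ∀ y, 0 < y → f y ≤ Real.exp (-(μ * y)) := by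
    intro y hy
    have hanti : AntitoneOn (fun y => Real.exp (μ * y) * f y) (Set.Ici 0) := by
      have hder : ∀ z, HasDerivAt (fun y => Real.exp (μ * y) * f y)
          (Real.exp (μ * z) * (μ * 1) * f z + Real.exp (μ * z) * deriv f z) z := fun z =>
        ((((hasDerivAt_id z).const_mul μ).exp).mul (hd z).hasDerivAt)
      refine antitoneOn_of_deriv_nonpos (convex_Ici 0)
        (fun z _ => (hder z).continuousAt.continuousWithinAt)
        (fun z _ => (hder z).differentiableAt.differentiableWithinAt) fun z hz => ?_
      rw [interior_Ici] at hz
      rw [(hder z).deriv, hdf]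
      have := hyperSeries_ge hσ (hf (z + 1)) Finset.univ z ⟨hz, by linarith⟩
      have h2 := mul_nonneg (Real.exp_pos (μ * z)).le (sub_nonneg.2 this)
      linarith
    have h := hanti (Set.mem_Ici.2 le_rfl) (Set.mem_Ici.2 hy.le) hy.le
    have h0 : f 0 = 1 := hyperSeries_empty_zero
    simp only [mul_zero, Real.exp_zero, h0, mul_one] at h
    rw [Real.exp_neg, ← one_div, le_div_iff₀ (Real.exp_pos _), mul_comm]
    exact h
  obtain ⟨k⟩ : Nonempty (Fin m) := ⟨⟨0, hm⟩⟩
  have hk1 : 0 < σ k + 1 := by linarith [hσ k]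
  have hins : insert k (Finset.univ.erase k) = Finset.univ := Finset.insert_erase (Finset.mem_univ k)
  set w := hyperSeries σ Finset.univ with hw
  have hwpos : 0 < w 1 := hyperSeries_pos hσ (hf 2) Finset.univ 1 (by norm_num)
  have hlow : ∀ y, 1 ≤ y → w 1 ≤ y ^ (σ k + 1) * w y := by
    intro y hy
    have h := strictMonoOn_rpow_mul (hσ k) (differentiable_hyperSeries hσ Finset.univ)
      (Y := y + 1) fun z hz => by
        have := hyperSeries_ode hσ (Finset.notMem_erase k Finset.univ) z
        rw [hins] at this
        rw [this]
        exact hyperSeries_pos hσ (hf (y + 1)) _ z hz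
    have := h.monotoneOn ⟨zero_le_one, by linarith⟩ ⟨by linarith, by linarith⟩ hy
    simpa using this
  -- The mean value theorem on `[y, y + 1]` gives `w z = f y - f (y + 1) < f y`, which transfers the
  -- lower bound for `w = -f'` to `f`.
  have hlower : ∀ y, 1 ≤ y → w 1 ≤ (y + 1) ^ (σ k + 1) * f y := by
    intro y hy
    obtain ⟨z, hz, hz1⟩ := exists_deriv_eq_slope f (show y < y + 1 by linarith)
      hd.continuous.continuousOn hd.differentiableOn
    have h1 := hpos (y + 1) (by linarith)
    have h2 := hlow z (by linarith [hz.1])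
    have hz0 : 0 < z := by linarith [hz.1]
    rw [hdf] at hz1
    have h3 : w z ≤ f y := by
      rw [add_sub_cancel_left, div_one] at hz1
      change -w z = _ at hz1
      linarith
    refine h2.trans (mul_le_mul (Real.rpow_le_rpow hz0.le hz.2.le hk1.le) h3 ?_ ?_)
    · by_contra! h
      have := mul_neg_of_pos_of_neg (Real.rpow_pos_of_pos hz0 (σ k + 1)) h
      linarith
    · exact Real.rpow_nonneg (by linarith) _
  -- The factor `exp μ` compensates for writing `exp(-μ y)` in terms of `y + 1`.
  have hlim : Tendsto (fun y : ℝ => Real.exp μ * ((y + 1) ^ (σ k + 1) * Real.exp (-μ * (y + 1))))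
      atTop (nhds (Real.exp μ * 0)) :=
    ((tendsto_rpow_mul_exp_neg_mul_atTop_nhds_zero (σ k + 1) μ hμ).comp
      (tendsto_atTop_add_const_right atTop 1 tendsto_id)).const_mul _
  rw [mul_zero] at hlim
  have hle : w 1 ≤ 0 := by
    refine ge_of_tendsto hlim ?_
    filter_upwards [eventually_ge_atTop 1] with y hy
    refine (hlower y hy).trans ?_
    calc (y + 1) ^ (σ k + 1) * f y ≤ (y + 1) ^ (σ k + 1) * Real.exp (-(μ * y)) :=
          mul_le_mul_of_nonneg_left (hupper y (by linarith)) (Real.rpow_nonneg (by linarith) _)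
      _ = _ := by
        rw [mul_left_comm, ← Real.exp_add]
        ring_nf
  exact absurd hle (not_le.2 hwpos)

end

/-! ### The first zero, monotonicity of `F`, and the global inverse. -/

section
variable {m : ℕ} {σ : Fin m → ℝ}

theorem normHyperBessel_zero : normHyperBessel σ 0 = 1 := by
  rw [normHyperBessel_eq]; simp [hyperSeries_empty_zero]

theorem continuous_normHyperBessel (hσ : ∀ j, -1 < σ j) : Continuous (normHyperBessel σ) := by
  have h : normHyperBessel σ = fun x => hyperSeries σ ∅ ((x / ((m : ℝ) + 1)) ^ (m + 1)) :=
    funext normHyperBessel_eq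
  rw [h]
  exact (differentiable_hyperSeries hσ ∅).continuous.comp (by fun_prop)

theorem isLeast_hyperBesselFirstZero (hm : 1 ≤ m) (hσ : ∀ j, -1 < σ j) :
    IsLeast {x : ℝ | 0 < x ∧ normHyperBessel σ x = 0} (hyperBesselFirstZero σ) := by
  -- As `F(0) = 1`, allowing `x = 0` adds no zero; the set is therefore closed and contains its
  -- infimum.
  have hset : {x : ℝ | 0 < x ∧ normHyperBessel σ x = 0} =
      Set.Ici 0 ∩ normHyperBessel σ ⁻¹' {0} := by
    ext x
    simp only [Set.mem_ofPred_eq, Set.mem_inter_iff, Set.mem_Ici, Set.mem_preimage,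
      Set.mem_singleton_iff]
    refine ⟨fun h => ⟨h.1.le, h.2⟩, fun h => ⟨h.1.lt_of_ne' ?_, h.2⟩⟩
    rintro rfl
    exact one_ne_zero (normHyperBessel_zero.symm.trans h.2)
  have hbdd : BddBelow {x : ℝ | 0 < x ∧ normHyperBessel σ x = 0} := ⟨0, fun x hx => hx.1.le⟩
  refine ⟨?_, fun x hx => csInf_le hbdd hx⟩
  have hclosed : IsClosed {x : ℝ | 0 < x ∧ normHyperBessel σ x = 0} := by
    rw [hset]
    exact isClosed_Ici.inter (isClosed_singleton.preimage (continuous_normHyperBessel hσ))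
  refine hclosed.csInf_mem ?_ hbdd
  obtain ⟨y, hy, hy0⟩ := exists_hyperSeries_eq_zero hm hσ
  refine ⟨((m : ℝ) + 1) * y ^ (((m + 1 : ℕ) : ℝ)⁻¹), by positivity, ?_⟩
  rw [normHyperBessel_eq, mul_div_cancel_left₀ _ (by positivity),
    Real.rpow_inv_natCast_pow hy.le (Nat.succ_ne_zero m), hy0]

theorem normHyperBessel_pos (hm : 1 ≤ m) (hσ : ∀ j, -1 < σ j) {x : ℝ}
    (hx : x ∈ Set.Ico 0 (hyperBesselFirstZero σ)) : 0 < normHyperBessel σ x := by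
  by_contra! hle
  obtain ⟨z, hz, hz0⟩ := intermediate_value_Icc' hx.1
    (continuous_normHyperBessel hσ).continuousOn
    (show (0 : ℝ) ∈ Set.Icc _ _ from ⟨hle, by rw [normHyperBessel_zero]; simp⟩)
  rcases hz.1.eq_or_lt with h | h
  · rw [← h, normHyperBessel_zero] at hz0
    exact one_ne_zero hz0
  · exact absurd ((isLeast_hyperBesselFirstZero hm hσ).2 ⟨h, hz0⟩) (by linarith [hz.2, hx.2])

theorem strictAntiOn_normHyperBessel (hm : 1 ≤ m) (hσ : ∀ j, -1 < σ j) :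
    StrictAntiOn (normHyperBessel σ) (Set.Icc 0 (hyperBesselFirstZero σ)) := by
  have hj := (isLeast_hyperBesselFirstZero hm hσ).1.1
  set j := hyperBesselFirstZero σ
  have hp : (0 : ℝ) < (m : ℝ) + 1 := by positivity
  have hpos : ∀ y ∈ Set.Ioo 0 ((j / ((m : ℝ) + 1)) ^ (m + 1)), 0 < hyperSeries σ ∅ y := by
    intro y hy
    have h := normHyperBessel_pos hm hσ (x := ((m : ℝ) + 1) * y ^ (((m + 1 : ℕ) : ℝ)⁻¹)) ⟨by
      have := hy.1; positivity, by
      rw [← lt_div_iff₀' hp]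
      refine lt_of_pow_lt_pow_left₀ (m + 1) (by positivity) ?_
      rw [Real.rpow_inv_natCast_pow hy.1.le (Nat.succ_ne_zero m)]
      exact hy.2⟩
    rwa [normHyperBessel_eq, mul_div_cancel_left₀ _ (by positivity),
      Real.rpow_inv_natCast_pow hy.1.le (Nat.succ_ne_zero m)] at h
  have hanti : StrictAntiOn (hyperSeries σ ∅) (Set.Icc 0 ((j / ((m : ℝ) + 1)) ^ (m + 1))) := by
    refine strictAntiOn_of_deriv_neg (convex_Icc _ _)
      (differentiable_hyperSeries hσ ∅).continuous.continuousOn fun y hy => ?_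
    rw [interior_Icc] at hy
    rw [deriv_hyperSeries_empty hσ]
    exact neg_neg_of_pos (hyperSeries_pos hσ hpos Finset.univ y hy)
  intro x hx y hy hxy
  rw [normHyperBessel_eq, normHyperBessel_eq]
  have hx0 : 0 ≤ x / ((m : ℝ) + 1) := div_nonneg hx.1 hp.le
  have hy0 : 0 ≤ y / ((m : ℝ) + 1) := div_nonneg hy.1 hp.le
  refine hanti ⟨pow_nonneg hx0 _, pow_le_pow_left₀ hx0 ?_ _⟩
    ⟨pow_nonneg hy0 _, pow_le_pow_left₀ hy0 ?_ _⟩ (pow_lt_pow_left₀ ?_ hx0 (Nat.succ_ne_zero m))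
  · exact div_le_div_of_nonneg_right hx.2 hp.le
  · exact div_le_div_of_nonneg_right hy.2 hp.le
  · exact div_lt_div_of_pos_right hxy hp

theorem hyperTau_injOn (hm : 1 ≤ m) (hσ : ∀ j, -1 < σ j) :
    Set.InjOn (hyperTau σ) (Set.Ioo 0 (hyperBesselFirstZero σ)) := by
  have hanti := strictAntiOn_normHyperBessel hm hσ
  have hpos : ∀ x ∈ Set.Ioo 0 (hyperBesselFirstZero σ), 0 < normHyperBessel σ x := fun x hx =>
    normHyperBessel_pos hm hσ ⟨hx.1.le, hx.2⟩
  have hlog : ∀ x ∈ Set.Ioo 0 (hyperBesselFirstZero σ),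
      0 ≤ -Real.log (normHyperBessel σ x) := fun x hx => by
    have h := hanti ⟨le_rfl, (hx.1.trans hx.2).le⟩ ⟨hx.1.le, hx.2.le⟩ hx.1
    rw [normHyperBessel_zero] at h
    exact neg_nonneg.2 (Real.log_nonpos (hpos x hx).le h.le)
  intro x hx y hy hxy
  have h1 := (Real.rpow_left_inj (hlog x hx) (hlog y hy) (by positivity)).1 hxy
  exact hanti.injOn ⟨hx.1.le, hx.2.le⟩ ⟨hy.1.le, hy.2.le⟩
    (Real.log_injOn_pos (hpos x hx) (hpos y hy) (neg_injective h1))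

/-- Injectivity of `hyperTau` identifies any explicit solution of `F(x) = exp(-τ^p)` below the first
zero with the chosen inverse `hyperX`. -/
theorem hyperX_eq (hm : 1 ≤ m) (hσ : ∀ j, -1 < σ j) {x τ : ℝ} (hτ : 0 ≤ τ)
    (hx : x ∈ Set.Ioo 0 (hyperBesselFirstZero σ))
    (h : normHyperBessel σ x = Real.exp (-τ ^ (m + 1))) : hyperX σ τ = x := by
  have hT : hyperTau σ x = τ := by
    have := Real.pow_rpow_inv_natCast hτ (Nat.succ_ne_zero m)
    rw [hyperTau, h, Real.log_exp, neg_neg, one_div]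
    exact_mod_cast this
  rw [← hT]
  exact (hyperTau_injOn hm hσ).leftInvOn_invFunOn hx

end

/-! ### Analytic local inversion. -/

open Topology in
/-- Local solution of `f (x) = exp (-s)` near a point where `f = 1`, in the form `x = s k(s) / μ`
with `k = h ^ (m + 1)`. -/
theorem exists_local_inverse {f : ℝ → ℝ} (hf : AnalyticAt ℝ f 0) (h0 : f 0 = 1) {μ : ℝ}
    (hμ : 0 < μ) (h1 : deriv f 0 = -μ) (m : ℕ) :
    ∃ k h : ℝ → ℝ, AnalyticAt ℝ k 0 ∧ AnalyticAt ℝ h 0 ∧ k 0 = 1 ∧ h 0 = 1 ∧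
      (∀ᶠ s in 𝓝 0, h s ^ (m + 1) = k s) ∧
      ∀ᶠ s in 𝓝 0, f (s * k s / μ) = Real.exp (-s) := by
  set q : ℝ → ℝ := fun t => -Real.log (f (t / μ)) with hq
  have hdiv : AnalyticAt ℝ (fun t : ℝ => t / μ) 0 := analyticAt_id.div_const
  have hfd : AnalyticAt ℝ (fun t => f (t / μ)) 0 :=
    AnalyticAt.comp (g := f) (by simpa using hf) hdiv
  have hqa : AnalyticAt ℝ q 0 := (hfd.log (by simp [h0])).neg
  have hq0 : q 0 = 0 := by simp [hq, h0]
  have hqd : HasDerivAt q 1 0 := by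
    have e1 : HasDerivAt f (-μ) ((0 : ℝ) / μ) := by
      rw [zero_div, ← h1]; exact hf.differentiableAt.hasDerivAt
    have e2 : HasDerivAt (fun t : ℝ => f (t / μ)) (-μ * (1 / μ)) 0 :=
      e1.comp (0 : ℝ) ((hasDerivAt_id (0 : ℝ)).div_const μ)
    have e3 := (e2.log (by simp [h0])).neg
    convert! e3 using 1
    simp [h0, hμ.ne']
  have hqd' : deriv q 0 ≠ 0 := by rw [hqd.deriv]; exact one_ne_zero
  set g : ℝ → ℝ := hqa.hasStrictDerivAt.localInverse _ _ _ hqd' with hg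
  have hga : AnalyticAt ℝ g 0 := by
    have := hqa.analyticAt_localInverse hqd'
    rwa [hq0] at this
  have hgr : ∀ᶠ s in 𝓝 0, q (g s) = s := by
    have := hqa.hasStrictDerivAt.eventually_right_inverse hqd'
    rwa [hq0] at this
  have hg0 : g 0 = 0 := by
    have := (hqa.hasStrictDerivAt.eventually_left_inverse hqd').self_of_nhds
    rwa [hq0] at this
  have hgd : deriv g 0 = 1 := by
    have := (hqa.hasStrictDerivAt.to_localInverse hqd').hasDerivAt
    rw [hq0] at this
    rw [hg, this.deriv, hqd.deriv, inv_one]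
  obtain ⟨P, hP⟩ := hga
  have hka : AnalyticAt ℝ (dslope g 0) 0 := ⟨_, hP.has_fpower_series_dslope_fslope⟩
  have hk0 : dslope g 0 0 = 1 := by rw [dslope_same, hgd]
  have hgk : ∀ s, g s = s * dslope g 0 s := fun s => by
    have := sub_smul_dslope g 0 s
    rw [hg0, sub_zero, sub_zero, smul_eq_mul] at this
    exact this.symm
  have hkpos : ∀ᶠ s in 𝓝 0, 0 < dslope g 0 s :=
    hka.continuousAt.eventually (lt_mem_nhds (by rw [hk0]; exact one_pos))
  -- `dslope g 0` is `g(s)/s` with the singularity removed; as it is near `1`, its root is analytic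
  -- as `exp(log k / (m + 1))`.
  refine ⟨dslope g 0, fun s => Real.exp (Real.log (dslope g 0 s) / ((m + 1 : ℕ) : ℝ)), hka,
    ((hka.log (by rw [hk0]; exact one_pos)).div_const).rexp', hk0, by
      simp only [hk0, Real.log_one, zero_div, Real.exp_zero], ?_, ?_⟩
  · filter_upwards [hkpos] with s hs
    rw [← Real.exp_nat_mul, mul_div_cancel₀ _ (by positivity), Real.exp_log hs]
  -- `Real.log` ignores signs, so `f > 0` along the inverse is needed before exponentiating.
  · have hcont : Tendsto (fun s => f (g s / μ)) (𝓝 0) (𝓝 1) := by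
      have h3 : ContinuousAt (fun s => g s / μ) 0 := hP.continuousAt.div_const μ
      have h4 : ContinuousAt f (g 0 / μ) := by rw [hg0, zero_div]; exact hf.continuousAt
      have h5 := (ContinuousAt.comp' (f := fun s => g s / μ) (g := f) (x := 0) h4 h3).tendsto
      simpa only [hg0, zero_div, h0] using h5
    filter_upwards [hgr, hcont.eventually (lt_mem_nhds one_pos)] with s hs hpos
    rw [← hgk, show -s = Real.log (f (g s / μ)) by linarith [show -Real.log (f (g s / μ)) = s from hs],
      Real.exp_log hpos]

/-! ### Calculus of truncated Taylor expansions. -/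

-- The limit at `0` kills the constant term; dividing by `s`, legitimate on the punctured
-- neighbourhood, lowers `N` by one. This is what makes Taylor coefficients unique in
-- `HasTaylor.coeff_eq`.
open Topology in
theorem Polynomial.X_pow_dvd_of_isBigO {N : ℕ} {q : Polynomial ℝ}
    (h : (fun s => q.eval s) =O[𝓝[≠] 0] fun s : ℝ => s ^ N) : Polynomial.X ^ N ∣ q := by
  induction N generalizing q with
  | zero => simp
  | succ N ih =>
    have h0 : q.eval 0 = 0 := by
      have h1 : Tendsto (fun s => q.eval s) (𝓝[≠] 0) (𝓝 (q.eval 0)) :=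
        q.continuous.continuousAt.tendsto.mono_left nhdsWithin_le_nhds
      have h2 : Tendsto (fun s : ℝ => s ^ (N + 1)) (𝓝[≠] 0) (𝓝 0) := by
        have : Tendsto (fun s : ℝ => s ^ (N + 1)) (𝓝 0) (𝓝 (0 ^ (N + 1))) :=
          (continuous_pow _).continuousAt
        rw [zero_pow (Nat.succ_ne_zero N)] at this
        exact this.mono_left nhdsWithin_le_nhds
      exact tendsto_nhds_unique h1 (h.trans_tendsto h2)
    obtain ⟨r, rfl⟩ : Polynomial.X ∣ q := by
      rwa [Polynomial.X_dvd_iff, Polynomial.coeff_zero_eq_eval_zero]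
    rw [pow_succ']
    refine mul_dvd_mul_left _ (ih ?_)
    have h3 := (isBigO_refl (fun s : ℝ => s⁻¹) (𝓝[≠] 0)).mul h
    refine h3.congr' ?_ ?_
    · filter_upwards [self_mem_nhdsWithin] with s hs
      have hs : s ≠ 0 := hs
      simp [hs]
    · filter_upwards [self_mem_nhdsWithin] with s hs
      have hs : s ≠ 0 := hs
      rw [pow_succ', inv_mul_cancel_left₀ hs]

/-- `A` is the Taylor expansion of `u` at `0`, to order `N`. -/
def HasTaylor (N : ℕ) (u : ℝ → ℝ) (A : PowerSeries ℝ) : Prop :=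
  (fun s => u s - (A.trunc N).eval s) =O[nhds 0] fun s => s ^ N

namespace HasTaylor
variable {N : ℕ} {u v : ℝ → ℝ} {A B : PowerSeries ℝ}

theorem coeff_eq (hA : HasTaylor N u A) (hB : HasTaylor N u B) {n : ℕ} (hn : n < N) :
    PowerSeries.coeff n A = PowerSeries.coeff n B := by
  have h : (fun s => (B.trunc N - A.trunc N).eval s) =O[nhds 0] fun s : ℝ => s ^ N := by
    refine (hA.sub hB).congr_left fun s => ?_
    simp
  have h1 := Polynomial.X_pow_dvd_iff.1
    (Polynomial.X_pow_dvd_of_isBigO (h.mono nhdsWithin_le_nhds)) n hn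
  rw [Polynomial.coeff_sub, PowerSeries.coeff_trunc, PowerSeries.coeff_trunc, if_pos hn,
    if_pos hn] at h1
  linarith

theorem congr (hA : HasTaylor N u A) (h : u =ᶠ[nhds 0] v) : HasTaylor N v A :=
  IsBigO.congr' hA (h.mono fun s hs => by simp only [hs]) EventuallyEq.rfl

theorem isBigO_one (hA : HasTaylor N u A) : u =O[nhds 0] fun _ => (1 : ℝ) := by
  have h1 : (fun s : ℝ => s ^ N) =O[nhds 0] fun _ => (1 : ℝ) :=
    (continuous_pow N).continuousAt.isBigO_one ℝ
  have h2 : (fun s : ℝ => (A.trunc N).eval s) =O[nhds 0] fun _ => (1 : ℝ) :=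
    (A.trunc N).continuous.continuousAt.isBigO_one ℝ
  refine ((IsBigO.trans hA h1).add h2).congr_left fun s => by simp

theorem mul (hA : HasTaylor N u A) (hB : HasTaylor N v B) :
    HasTaylor N (fun s => u s * v s) (A * B) := by
  have h1 : (fun s => (u s - (A.trunc N).eval s) * v s) =O[nhds 0] fun s => s ^ N :=
    (IsBigO.mul hA hB.isBigO_one).congr_right fun s => mul_one _
  have h2 : (fun s => (A.trunc N).eval s * (v s - (B.trunc N).eval s)) =O[nhds 0]
      fun s => s ^ N :=
    (((A.trunc N).continuous.continuousAt.isBigO_one ℝ).mul hB).congr_right fun s => one_mul _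
  obtain ⟨r, hr⟩ : Polynomial.X ^ N ∣ A.trunc N * B.trunc N - (A * B).trunc N := by
    refine Polynomial.X_pow_dvd_iff.2 fun n hn => ?_
    rw [Polynomial.coeff_sub, PowerSeries.coeff_trunc, if_pos hn,
      PowerSeries.coeff_mul_eq_coeff_trunc_mul_trunc A B hn, ← Polynomial.coe_mul,
      Polynomial.coeff_coe, sub_self]
  have h3 : (fun s => (A.trunc N * B.trunc N - (A * B).trunc N).eval s) =O[nhds 0]
      fun s => s ^ N := by
    rw [hr]
    refine (((isBigO_refl (fun s : ℝ => s ^ N) (nhds 0)).mul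
      (r.continuous.continuousAt.isBigO_one ℝ)).congr_right fun s => mul_one _).congr_left
      fun s => by simp
  refine ((h1.add h2).add h3).congr_left fun s => ?_
  simp only [Polynomial.eval_sub, Polynomial.eval_mul]
  ring

theorem const (N : ℕ) (c : ℝ) : HasTaylor N (fun _ => c) (PowerSeries.C c) := by
  rcases N with _ | N
  · simpa [HasTaylor] using isBigO_const_const c (one_ne_zero (α := ℝ)) (nhds (0 : ℝ))
  · refine (isBigO_zero _ _).congr_left fun s => ?_
    rw [PowerSeries.trunc_C, Polynomial.eval_C, sub_self]

theorem id (N : ℕ) : HasTaylor N (fun s => s) PowerSeries.X := by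
  rcases N with _ | _ | N
  · simpa [HasTaylor] using (continuous_id (X := ℝ)).continuousAt.isBigO_one ℝ
  · have : PowerSeries.trunc 1 (PowerSeries.X : PowerSeries ℝ) = 0 := by
      ext n
      rw [PowerSeries.coeff_trunc]
      rcases n with _ | n <;> simp
    simpa [HasTaylor, this] using isBigO_refl (fun s : ℝ => s) (nhds 0)
  · refine (isBigO_zero _ _).congr_left fun s => ?_
    rw [PowerSeries.trunc_X, Polynomial.eval_X, sub_self]

theorem pow (hA : HasTaylor N u A) (n : ℕ) : HasTaylor N (fun s => u s ^ n) (A ^ n) := by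
  induction n with
  | zero => simpa using const N 1
  | succ n ih =>
    simp only [pow_succ]
    exact ih.mul hA

theorem add (hA : HasTaylor N u A) (hB : HasTaylor N v B) :
    HasTaylor N (fun s => u s + v s) (A + B) := by
  refine (IsBigO.add hA hB).congr_left fun s => ?_
  rw [map_add, Polynomial.eval_add]
  ring

theorem sum {ι : Type*} {w : ι → ℝ → ℝ} {C : ι → PowerSeries ℝ} (S : Finset ι)
    (h : ∀ i ∈ S, HasTaylor N (w i) (C i)) :
    HasTaylor N (fun s => ∑ i ∈ S, w i s) (∑ i ∈ S, C i) := by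
  classical
  induction S using Finset.induction_on with
  | empty => simpa using const N 0
  | insert i S hi ih =>
    simp only [Finset.sum_insert hi]
    exact (h i (Finset.mem_insert_self i S)).add
      (ih fun j hj => h j (Finset.mem_insert_of_mem hj))

theorem eval_trunc (N : ℕ) (A : PowerSeries ℝ) (s : ℝ) :
    (A.trunc N).eval s = ∑ n ∈ Finset.range N, PowerSeries.coeff n A * s ^ n := by
  simpa using PowerSeries.eval₂_trunc_eq_sum_range s (RingHom.id ℝ) N A

/-- As `v = O(s)`, replacing `u` by its polynomial of degree below `N` costs `O(s^N)`. The finite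
sum stands in for formal substitution and keeps each coefficient computable. -/
theorem comp (hA : HasTaylor N u A) (hB : HasTaylor N v B) (hv : v =O[nhds 0] fun s => s) :
    HasTaylor N (fun s => u (v s))
      (∑ n ∈ Finset.range N, PowerSeries.C (PowerSeries.coeff n A) * B ^ n) := by
  have hv0 : Tendsto v (nhds 0) (nhds 0) := hv.trans_tendsto (tendsto_id)
  have h1 : (fun s => u (v s) - (A.trunc N).eval (v s)) =O[nhds 0] fun s => s ^ N :=
    (IsBigO.comp_tendsto hA hv0).trans (hv.pow N)
  have h2 : HasTaylor N (fun s => ∑ n ∈ Finset.range N, PowerSeries.coeff n A * v s ^ n)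
      (∑ n ∈ Finset.range N, PowerSeries.C (PowerSeries.coeff n A) * B ^ n) :=
    sum _ fun n _ => (const N _).mul (hB.pow n)
  refine (h1.add h2).congr_left fun s => ?_
  rw [eval_trunc]
  ring

end HasTaylor

theorem HasFPowerSeriesAt.hasTaylor {u : ℝ → ℝ} {a : ℕ → ℝ}
    (h : HasFPowerSeriesAt u (FormalMultilinearSeries.ofScalars ℝ a) 0) (N : ℕ) :
    HasTaylor N u (PowerSeries.mk a) := by
  have h1 := h.isBigO_sub_partialSum_pow N
  refine IsBigO.congr_left ?_ (f₁ := fun s : ℝ =>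
    u (0 + s) - (FormalMultilinearSeries.ofScalars ℝ a).partialSum N s) fun s => ?_
  · refine h1.trans ?_
    exact IsBigO.of_bound 1 (Eventually.of_forall fun s => by simp)
  · rw [zero_add, FormalMultilinearSeries.partialSum, HasTaylor.eval_trunc]
    simp [mul_comm]

theorem AnalyticAt.hasTaylor {u : ℝ → ℝ} (h : AnalyticAt ℝ u 0) (N : ℕ) :
    HasTaylor N u (PowerSeries.mk fun n => iteratedDeriv n u 0 / (n.factorial : ℝ)) :=
  h.hasFPowerSeriesAt.hasTaylor N

theorem AnalyticAt.hasTaylor_deriv {u : ℝ → ℝ} (h : AnalyticAt ℝ u 0) (N : ℕ) :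
    HasTaylor N (deriv u) (PowerSeries.mk fun n =>
      ((n : ℝ) + 1) * (iteratedDeriv (n + 1) u 0 / ((n + 1).factorial : ℝ))) := by
  convert! h.deriv.hasTaylor N using 2
  funext n
  rw [iteratedDeriv_succ', Nat.factorial_succ]
  push_cast
  field_simp

theorem hasTaylor_exp_neg (N : ℕ) :
    HasTaylor N (fun s => Real.exp (-s))
      (PowerSeries.mk fun n => (-1) ^ n / (n.factorial : ℝ)) := by
  have h : AnalyticAt ℝ (fun s : ℝ => Real.exp (-s)) 0 := analyticAt_id.neg.rexp'
  convert! h.hasTaylor N using 3 with n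
  rw [iteratedDeriv_comp_neg, iteratedDeriv_eq_iterate, Real.iter_deriv_exp]
  simp

/-! ### Comparison of coefficients. -/

theorem PowerSeries.coeff_mul_eq_sum_range (n : ℕ) (A B : PowerSeries ℝ) :
    PowerSeries.coeff n (A * B) =
      ∑ i ∈ Finset.range (n + 1), PowerSeries.coeff i A * PowerSeries.coeff (n - i) B := by
  rw [PowerSeries.coeff_mul, Finset.Nat.sum_antidiagonal_eq_sum_range_succ_mk]

/-- The first Taylor coefficients of the solution `k` of `f (s k(s) / μ) = exp (-s)`. -/
theorem coeffs_of_comp_eq_exp_neg {f k : ℝ → ℝ} {a κ : ℕ → ℝ} {μ : ℝ}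
    (hf : HasTaylor 6 f (PowerSeries.mk a)) (hk : HasTaylor 6 k (PowerSeries.mk κ))
    (h0 : κ 0 = 1) (h : ∀ᶠ s in nhds 0, f (s * k s / μ) = Real.exp (-s)) :
    a 2 / μ ^ 2 + a 1 / μ * κ 1 = 1 / 2 ∧
    a 3 / μ ^ 3 + a 2 / μ ^ 2 * (2 * κ 1) + a 1 / μ * κ 2 = -1 / 6 ∧
    a 4 / μ ^ 4 + a 3 / μ ^ 3 * (3 * κ 1) + a 2 / μ ^ 2 * (2 * κ 2 + κ 1 ^ 2) + a 1 / μ * κ 3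
      = 1 / 24 ∧
    a 5 / μ ^ 5 + a 4 / μ ^ 4 * (4 * κ 1) + a 3 / μ ^ 3 * (3 * κ 2 + 3 * κ 1 ^ 2)
      + a 2 / μ ^ 2 * (2 * κ 3 + 2 * κ 1 * κ 2) + a 1 / μ * κ 4 = -1 / 120 := by
  have hG : HasTaylor 6 (fun s => s * k s / μ)
      -- The factor `X` shifts degrees by one: `κ 4` enters at degree `5`, which is why order `6` is
      -- used.
      (PowerSeries.X * PowerSeries.mk κ * PowerSeries.C μ⁻¹) :=
    ((HasTaylor.id 6).mul hk).mul (HasTaylor.const 6 μ⁻¹)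
  have hO : (fun s => s * k s / μ) =O[nhds 0] fun s => s := by
    refine (((isBigO_refl (fun s : ℝ => s) (nhds 0)).mul (hk.isBigO_one)).mul
      (isBigO_refl (fun _ : ℝ => μ⁻¹) (nhds 0))).trans ?_
    exact IsBigO.of_bound |μ⁻¹| (Eventually.of_forall fun s => by simp [mul_comm])
  have hc := fun n hn => ((hf.comp hG hO).congr h).coeff_eq (hasTaylor_exp_neg 6) (n := n) hn
  have hpow : ∀ (i n : ℕ), PowerSeries.coeff n (PowerSeries.C (PowerSeries.coeff i
      (PowerSeries.mk a)) * (PowerSeries.X * PowerSeries.mk κ * PowerSeries.C μ⁻¹) ^ i) =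
      a i / μ ^ i * if i ≤ n then PowerSeries.coeff (n - i) (PowerSeries.mk κ ^ i) else 0 := by
    intro i n
    rw [mul_pow, mul_pow, ← map_pow, mul_comm (_ * _) (PowerSeries.C _), ← mul_assoc, ← map_mul,
      PowerSeries.coeff_C_mul, PowerSeries.coeff_X_pow_mul', PowerSeries.coeff_mk, inv_pow,
      div_eq_mul_inv]
  simp only [map_sum, hpow] at hc
  simp only [PowerSeries.coeff_mk, Finset.sum_range_succ, Finset.sum_range_zero] at hc
  have h2 := hc 2 (by norm_num)
  have h3 := hc 3 (by norm_num)
  have h4 := hc 4 (by norm_num)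
  have h5 := hc 5 (by norm_num)
  norm_num [pow_succ, PowerSeries.coeff_mul_eq_sum_range, Finset.sum_range_succ, Nat.factorial, h0,
    -PowerSeries.coeff_zero_eq_constantCoeff] at h2 h3 h4 h5
  refine ⟨?_, ?_, ?_, ?_⟩
  · linear_combination h2
  · linear_combination h3
  · linear_combination h4
  · linear_combination h5

/-- Differentiating `h^p = k` and multiplying by `h` gives `p h' k = h k'`. Here `p` is only a
scalar, so comparing coefficients yields a recursion linear in `η` in place of a `p`-th power
expansion. -/
theorem coeffs_of_pow_eq {k h : ℝ → ℝ} (hk : AnalyticAt ℝ k 0) (hh : AnalyticAt ℝ h 0)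
    {m : ℕ} (hpow : ∀ᶠ s in nhds 0, h s ^ (m + 1) = k s) {κ η : ℕ → ℝ}
    (hκ : ∀ n, κ n = iteratedDeriv n k 0 / (n.factorial : ℝ))
    (hη : ∀ n, η n = iteratedDeriv n h 0 / (n.factorial : ℝ))
    (hκ0 : κ 0 = 1) (hη0 : η 0 = 1) {p : ℝ} (hp : p = (m : ℝ) + 1) :
    p * η 1 = κ 1 ∧
    p * (2 * η 2 + η 1 * κ 1) = 2 * κ 2 + η 1 * κ 1 ∧
    p * (3 * η 3 + 2 * η 2 * κ 1 + η 1 * κ 2) = 3 * κ 3 + 2 * η 1 * κ 2 + η 2 * κ 1 ∧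
    p * (4 * η 4 + 3 * η 3 * κ 1 + 2 * η 2 * κ 2 + η 1 * κ 3) =
      4 * κ 4 + 3 * η 1 * κ 3 + 2 * η 2 * κ 2 + η 3 * κ 1 := by
  have hd : ∀ᶠ s in nhds 0, p * (deriv h s * k s) = h s * deriv k s := by
    filter_upwards [hpow.eventually_nhds, hh.eventually_analyticAt] with s hs hhs
    have h1 : deriv k s = ((m + 1 : ℕ) : ℝ) * h s ^ m * deriv h s := by
      have h2 : (fun s => h s ^ (m + 1)) =ᶠ[nhds s] k := hs
      rw [← h2.deriv_eq]
      exact (hhs.differentiableAt.hasDerivAt.pow (m + 1)).deriv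
    rw [h1, ← hs.self_of_nhds, hp]
    push_cast
    ring
  have e1 := (HasTaylor.const 4 p).mul ((hh.hasTaylor_deriv 4).mul (hk.hasTaylor 4))
  have e2 := (hh.hasTaylor 4).mul (hk.hasTaylor_deriv 4)
  have hc := fun n hn => (e1.congr hd).coeff_eq e2 (n := n) hn
  simp only [← hκ, ← hη, PowerSeries.coeff_C_mul] at hc
  have h0 := hc 0 (by norm_num)
  have h1 := hc 1 (by norm_num)
  have h2 := hc 2 (by norm_num)
  have h3 := hc 3 (by norm_num)
  norm_num [PowerSeries.coeff_mul_eq_sum_range, Finset.sum_range_succ, hκ0, hη0,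
    -PowerSeries.coeff_zero_eq_constantCoeff] at h0 h1 h2 h3
  refine ⟨?_, ?_, ?_, ?_⟩
  · linear_combination h0
  · linear_combination h1
  · linear_combination h2
  · linear_combination h3

section
variable {m : ℕ} {σ : Fin m → ℝ}

/-- Consecutive coefficients of `f` have ratio `-μ_{n+1}/(n+1)`, so dividing the `n`-th by `μ₁^n`
leaves `(-1)^n γ_2 ⋯ γ_n / n!`. -/
theorem hyperCoeff_empty_div_pow (hσ : ∀ j, -1 < σ j) {γ : ℕ → ℝ}
    (hγ : ∀ k, γ k = hyperGamma σ k) :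
    hyperCoeff σ ∅ 1 / hyperMu σ 1 = -1 ∧
    hyperCoeff σ ∅ 2 / hyperMu σ 1 ^ 2 = γ 2 / 2 ∧
    hyperCoeff σ ∅ 3 / hyperMu σ 1 ^ 3 = -(γ 2 * γ 3) / 6 ∧
    hyperCoeff σ ∅ 4 / hyperMu σ 1 ^ 4 = γ 2 * γ 3 * γ 4 / 24 ∧
    hyperCoeff σ ∅ 5 / hyperMu σ 1 ^ 5 = -(γ 2 * γ 3 * γ 4 * γ 5) / 120 := by
  have h0 : hyperCoeff σ ∅ 0 = 1 := by simp [hyperCoeff]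
  have hμ := (hyperMu_pos hσ (k := 1) le_rfl).ne'
  have hr : ∀ n : ℕ, hyperCoeff σ ∅ (n + 1) / hyperMu σ 1 ^ (n + 1) =
      -γ (n + 1) / ((n : ℝ) + 1) * (hyperCoeff σ ∅ n / hyperMu σ 1 ^ n) := by
    intro n
    have h := hyperCoeff_empty_succ hσ n
    have hn : (n : ℝ) + 1 ≠ 0 := by positivity
    rw [hyperCoeff_univ] at h
    rw [hγ, hyperGamma]
    rw [eq_div_of_mul_eq hn (mul_comm _ _ |>.trans h)]
    field_simp
    ring
  have g1 : γ 1 = 1 := by rw [hγ, hyperGamma, div_self hμ]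
  have h1 := hr 0
  have h2 := hr 1
  have h3 := hr 2
  have h4 := hr 3
  have h5 := hr 4
  simp only [h0, g1, zero_add, pow_one, pow_zero, Nat.reduceAdd, Nat.cast_zero, Nat.cast_one,
    Nat.cast_ofNat] at h1 h2 h3 h4 h5
  rw [h1] at h2
  rw [h2] at h3
  rw [h3] at h4
  rw [h4] at h5
  refine ⟨?_, ?_, ?_, ?_, ?_⟩
  · rw [h1]; norm_num
  · rw [h2]; ring
  · rw [h3]; ring
  · rw [h4]; ring
  · rw [h5]; ring

/-- Local inversion of `x ↦ -log F(x)` with the first Taylor coefficients. -/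
theorem exists_hyper_local_inverse (hσ : ∀ j, -1 < σ j) {p : ℝ} (hp : p = (m : ℝ) + 1)
    {γ : ℕ → ℝ} (hγ : ∀ k, γ k = hyperGamma σ k) :
    ∃ h : ℝ → ℝ, AnalyticAt ℝ h 0 ∧ h 0 = 1 ∧
      (∀ᶠ s in nhds 0, hyperSeries σ ∅ (s * h s ^ (m + 1) / hyperMu σ 1) = Real.exp (-s)) ∧
      ∀ A : ℕ → ℝ, (∀ n, A n = (-p) ^ n * (iteratedDeriv n h 0 / (n.factorial : ℝ))) →
      A 0 = 1 ∧
      A 1 = 1 / 2 * (1 - γ 2) ∧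
      A 2 = 1 / 24 * (p + 3 - 6 * (p + 1) * γ 2 + 3 * (3 * p + 1) * γ 2 ^ 2
        - 4 * p * γ 2 * γ 3) ∧
      A 3 = 1 / 48 * (p + 1 - (p + 1) * (4 * p + 3) * γ 2
        + 3 * (2 * p + 1) * (3 * p + 1) * γ 2 ^ 2 - 4 * p * (2 * p + 1) * γ 2 * γ 3
        - γ 2 * ((1 + 9 * p + 20 * p ^ 2) * γ 2 ^ 2 - 4 * p * (4 * p + 1) * γ 2 * γ 3
          + 2 * p ^ 2 * γ 3 * γ 4)) ∧
      A 4 = 1 / 5760 * (15 + 30 * p + 5 * p ^ 2 - 2 * p ^ 3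
        - 60 * (p + 1) ^ 2 * (2 * p + 1) * γ 2
        + 10 * (3 + 13 * p + 14 * p ^ 2) * γ 2 * (3 * (3 * p + 1) * γ 2 - 4 * p * γ 3)
        - 60 * (3 * p + 1) * γ 2 * ((1 + 9 * p + 20 * p ^ 2) * γ 2 ^ 2
          - 4 * p * (4 * p + 1) * γ 2 * γ 3 + 2 * p ^ 2 * γ 3 * γ 4)
        + γ 2 * (15 * (1 + 18 * p + 107 * p ^ 2 + 210 * p ^ 3) * γ 2 ^ 3
          - 120 * p * (1 + 11 * p + 30 * p ^ 2) * γ 2 ^ 2 * γ 3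
          + 40 * p ^ 2 * (5 * p + 1) * γ 2 * γ 3 * (2 * γ 3 + 3 * γ 4)
          - 48 * p ^ 3 * γ 3 * γ 4 * γ 5)) := by
  have hμ := hyperMu_pos hσ (k := 1) le_rfl
  have hf := (hasFPowerSeriesOnBall_hyperSeries hσ ∅).hasFPowerSeriesAt
  obtain ⟨d1, d2, d3, d4, d5⟩ := hyperCoeff_empty_div_pow hσ hγ
  have hder : deriv (hyperSeries σ ∅) 0 = -hyperMu σ 1 := by
    rw [deriv_hyperSeries_empty hσ, hyperSeries_zero, hyperCoeff_univ]
    simp [hyperCoeff]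
  obtain ⟨k, h, hk, hh, hk0, hh0, hpow, heq⟩ :=
    exists_local_inverse hf.analyticAt hyperSeries_empty_zero hμ hder m
  refine ⟨h, hh, hh0, ?_, fun A hA => ?_⟩
  · filter_upwards [hpow, heq] with s h1 h2
    rw [h1, h2]
  set κ : ℕ → ℝ := fun n => iteratedDeriv n k 0 / (n.factorial : ℝ) with hκ
  set η : ℕ → ℝ := fun n => iteratedDeriv n h 0 / (n.factorial : ℝ) with hη
  have hκ0 : κ 0 = 1 := by simp [hκ, hk0]
  have hη0 : η 0 = 1 := by simp [hη, hh0]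
  obtain ⟨c1, c2, c3, c4⟩ := coeffs_of_comp_eq_exp_neg (hf.hasTaylor 6) (hk.hasTaylor 6) hκ0 heq
  obtain ⟨e1, e2, e3, e4⟩ := coeffs_of_pow_eq hk hh hpow (fun _ => rfl) (fun _ => rfl) hκ0 hη0 hp
  change ∀ n, A n = (-p) ^ n * η n at hA
  rw [d1, d2] at c1
  rw [d1, d2, d3] at c2
  rw [d1, d2, d3, d4] at c3
  rw [d1, d2, d3, d4, d5] at c4
  change _ + -1 * κ 1 = _ at c1
  change _ + _ * (2 * κ 1) + -1 * κ 2 = _ at c2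
  change _ + _ * (3 * κ 1) + _ * (2 * κ 2 + κ 1 ^ 2) + -1 * κ 3 = _ at c3
  change _ + _ * (4 * κ 1) + _ * (3 * κ 2 + 3 * κ 1 ^ 2) + _ * (2 * κ 3 + 2 * κ 1 * κ 2)
    + -1 * κ 4 = _ at c4
  change p * η 1 = κ 1 at e1
  change p * (2 * η 2 + η 1 * κ 1) = 2 * κ 2 + η 1 * κ 1 at e2
  change p * (3 * η 3 + 2 * η 2 * κ 1 + η 1 * κ 2) = 3 * κ 3 + 2 * η 1 * κ 2 + η 2 * κ 1 at e3
  change p * (4 * η 4 + 3 * η 3 * κ 1 + 2 * η 2 * κ 2 + η 1 * κ 3) =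
    4 * κ 4 + 3 * η 1 * κ 3 + 2 * η 2 * κ 2 + η 3 * κ 1 at e4
  -- Multiplying the `n`-th recursion by `p^(n-1)` turns each `p^i η i` into `±A i`, so the `A i`
  -- become polynomials in `p` and the `κ i`.
  have a1 : A 1 = -κ 1 := by rw [hA]; linear_combination -e1
  have a2 : A 2 = p * κ 2 + -A 1 * κ 1 * (1 - p) / 2 := by
    rw [hA, hA]; linear_combination p * e2 / 2
  have a3 : A 3 = -(3 * p ^ 2 * κ 3 + 2 * p * -A 1 * κ 2 + A 2 * κ 1 - 2 * p * A 2 * κ 1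
      - p ^ 2 * -A 1 * κ 2) / 3 := by
    rw [hA, hA, hA]; linear_combination -p ^ 2 * e3 / 3
  have a4 : A 4 = (4 * p ^ 3 * κ 4 + 3 * p ^ 2 * -A 1 * κ 3 + 2 * p * A 2 * κ 2 + -A 3 * κ 1
      - 3 * p * -A 3 * κ 1 - 2 * p ^ 2 * A 2 * κ 2 - p ^ 3 * -A 1 * κ 3) / 4 := by
    rw [hA, hA, hA, hA]; linear_combination p ^ 3 * e4 / 4
  -- Each comparison with `exp(-s)` is linear in its newest `κ`, with coefficient `-1`.
  have k1 : κ 1 = (γ 2 - 1) / 2 := by linear_combination -c1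
  have k2 : κ 2 = -(γ 2 * γ 3) / 6 + γ 2 / 2 * (2 * κ 1) + 1 / 6 := by linear_combination -c2
  have k3 : κ 3 = γ 2 * γ 3 * γ 4 / 24 + -(γ 2 * γ 3) / 6 * (3 * κ 1)
      + γ 2 / 2 * (2 * κ 2 + κ 1 ^ 2) - 1 / 24 := by linear_combination -c3
  have k4 : κ 4 = -(γ 2 * γ 3 * γ 4 * γ 5) / 120 + γ 2 * γ 3 * γ 4 / 24 * (4 * κ 1)
      + -(γ 2 * γ 3) / 6 * (3 * κ 2 + 3 * κ 1 ^ 2) + γ 2 / 2 * (2 * κ 3 + 2 * κ 1 * κ 2)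
      + 1 / 120 := by linear_combination -c4
  rw [k1] at k2
  rw [k1, k2] at k3
  rw [k1, k2, k3] at k4
  rw [k1] at a1
  rw [a1, k1, k2] at a2
  rw [a1, a2, k1, k2, k3] at a3
  rw [a1, a2, a3, k1, k2, k3, k4] at a4
  refine ⟨by rw [hA, hη0]; simp, ?_, ?_, ?_, ?_⟩
  · rw [a1]; ring
  · rw [a2]; ring
  · rw [a3]; ring
  · rw [a4]; ring

end

/-! ### Watson's lemma. -/

open MeasureTheory in
theorem integrableOn_pow_mul_exp_neg_mul_pow (q m : ℕ) {n : ℝ} (hn : 0 < n) :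
    IntegrableOn (fun τ : ℝ => τ ^ q * Real.exp (-(n * τ ^ (m + 1)))) (Set.Ioi 0) := by
  have h := integrableOn_rpow_mul_exp_neg_mul_rpow (s := (q : ℝ)) (p := ((m + 1 : ℕ) : ℝ)) (b := n)
    (by linarith [(q.cast_nonneg : (0 : ℝ) ≤ q)]) (by positivity) hn
  simpa only [Real.rpow_natCast, neg_mul] using h

open MeasureTheory in
theorem integral_pow_mul_exp_neg_mul_pow (q m : ℕ) {n : ℝ} (hn : 0 < n) :
    ∫ τ in Set.Ioi (0 : ℝ), τ ^ q * Real.exp (-(n * τ ^ (m + 1))) =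
      n ^ (-((q : ℝ) + 1) / ((m : ℝ) + 1)) * (1 / ((m : ℝ) + 1)) *
        Real.Gamma (((q : ℝ) + 1) / ((m : ℝ) + 1)) := by
  have h := integral_rpow_mul_exp_neg_mul_rpow (q := (q : ℝ)) (p := ((m + 1 : ℕ) : ℝ)) (b := n)
    (by positivity) (by linarith [(q.cast_nonneg : (0 : ℝ) ≤ q)]) hn
  simp only [Real.rpow_natCast, neg_mul] at h
  push_cast at h
  exact h

open MeasureTheory in
/-- Watson's lemma for `∫ exp (-n τ ^ (m + 1)) E τ` with an expansion of `E` in powers of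
`τ ^ (m + 1)`. -/
theorem watson_bound (m N : ℕ) {E : ℝ → ℝ} {b : ℕ → ℝ} {δ C : ℝ} (hδ : 0 < δ)
    (hE : ContinuousOn E (Set.Icc 0 δ))
    (hC : ∀ τ ∈ Set.Icc 0 δ,
      |E τ - ∑ k ∈ Finset.range N, b k * τ ^ (k * (m + 1))| ≤ C * τ ^ (N * (m + 1))) :
    ∃ C', ∀ n : ℝ, 0 < n →
      |(∫ τ in (0 : ℝ)..δ, Real.exp (-(n * τ ^ (m + 1))) * E τ) -
        ∑ k ∈ Finset.range N, b k * ∫ τ in Set.Ioi (0 : ℝ),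
          τ ^ (k * (m + 1)) * Real.exp (-(n * τ ^ (m + 1)))| ≤
      C' * n ^ (-(1 / ((m : ℝ) + 1)) - (N : ℝ)) := by
  set P : ℝ → ℝ := fun τ => ∑ k ∈ Finset.range N, b k * τ ^ (k * (m + 1)) with hP
  -- The integral is extended to `(0, ∞)` with `E` cut off at `δ`. Beyond `δ` only the polynomial
  -- remains, and there `τ^(kp) ≤ τ^(Np) / δ^((N-k)p)`; the sum in `D` pays for this.
  set D := |C| + ∑ k ∈ Finset.range N, |b k| / δ ^ ((N - k) * (m + 1)) with hD
  have hDC : |C| ≤ D := le_add_of_nonneg_right (Finset.sum_nonneg fun k _ => by positivity)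
  have hbound : ∀ τ ∈ Set.Ioi (0 : ℝ),
      |(Set.Ioc 0 δ).indicator E τ - P τ| ≤ D * τ ^ (N * (m + 1)) := by
    intro τ hτ
    have hτ : 0 < τ := hτ
    by_cases h : τ ≤ δ
    · rw [Set.indicator_of_mem (show τ ∈ Set.Ioc 0 δ from ⟨hτ, h⟩)]
      refine (hC τ ⟨hτ.le, h⟩).trans ?_
      gcongr
      exact (le_abs_self C).trans hDC
    · rw [Set.indicator_of_notMem (fun h' => h h'.2), zero_sub, abs_neg]
      calc |P τ| ≤ ∑ k ∈ Finset.range N, |b k * τ ^ (k * (m + 1))| := Finset.abs_sum_le_sum_abs _ _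
        _ ≤ ∑ k ∈ Finset.range N, |b k| / δ ^ ((N - k) * (m + 1)) * τ ^ (N * (m + 1)) := by
          refine Finset.sum_le_sum fun k hk => ?_
          have hk := Finset.mem_range.1 hk
          have e : N * (m + 1) = (N - k) * (m + 1) + k * (m + 1) := by
            rw [← add_mul, Nat.sub_add_cancel hk.le]
          rw [abs_mul, abs_of_pos (pow_pos hτ (k * (m + 1))), e, pow_add, ← mul_assoc]
          refine mul_le_mul_of_nonneg_right ?_ (pow_pos hτ _).le
          rw [div_mul_eq_mul_div, le_div_iff₀ (by positivity)]
          gcongr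
          exact (not_le.1 h).le
        _ ≤ D * τ ^ (N * (m + 1)) := by
          rw [← Finset.sum_mul]
          gcongr
          exact le_add_of_nonneg_left (abs_nonneg C)
  refine ⟨D * ((1 / ((m : ℝ) + 1)) *
    Real.Gamma (((N * (m + 1) : ℕ) + 1 : ℝ) / ((m : ℝ) + 1))), fun n hn => ?_⟩
  set e : ℝ → ℝ := fun τ => Real.exp (-(n * τ ^ (m + 1))) with he
  have hecont : Continuous e := by fun_prop
  have hint : ∀ q : ℕ, IntegrableOn (fun τ => τ ^ q * e τ) (Set.Ioi 0) := fun q =>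
    integrableOn_pow_mul_exp_neg_mul_pow q m hn
  have hPe : (fun τ => P τ * e τ) = fun τ =>
      ∑ k ∈ Finset.range N, b k * (τ ^ (k * (m + 1)) * e τ) := by
    funext τ
    simp only [hP, Finset.sum_mul, mul_assoc]
  have hPint : IntegrableOn (fun τ => P τ * e τ) (Set.Ioi 0) := by
    rw [hPe]
    exact integrable_finsetSum _ fun k _ => (hint _).const_mul _
  have hsum : ∑ k ∈ Finset.range N, b k * ∫ τ in Set.Ioi (0 : ℝ), τ ^ (k * (m + 1)) * e τ =
      ∫ τ in Set.Ioi (0 : ℝ), P τ * e τ := by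
    rw [hPe, integral_finsetSum _ fun k _ => (hint _).const_mul _]
    exact Finset.sum_congr rfl fun k _ => (integral_const_mul _ _).symm
  have hind : (fun τ => (Set.Ioc 0 δ).indicator E τ * e τ) =
      (Set.Ioc 0 δ).indicator fun τ => e τ * E τ := by
    funext τ
    by_cases h : τ ∈ Set.Ioc 0 δ <;> simp [h, mul_comm]
  have hEint : IntegrableOn (fun τ => e τ * E τ) (Set.Ioc 0 δ) :=
    ((hecont.continuousOn.mul hE).integrableOn_Icc).mono_set Set.Ioc_subset_Icc_self
  have hIint : IntegrableOn (fun τ => (Set.Ioc 0 δ).indicator E τ * e τ) (Set.Ioi 0) := by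
    rw [hind]
    exact ((integrable_indicator_iff measurableSet_Ioc).2 hEint).integrableOn
  have hI : ∫ τ in (0 : ℝ)..δ, e τ * E τ =
      ∫ τ in Set.Ioi (0 : ℝ), (Set.Ioc 0 δ).indicator E τ * e τ := by
    rw [hind, setIntegral_indicator measurableSet_Ioc, intervalIntegral.integral_of_le hδ.le,
      Set.inter_eq_self_of_subset_right Set.Ioc_subset_Ioi_self]
  change |(∫ τ in (0 : ℝ)..δ, e τ * E τ) - ∑ k ∈ Finset.range N, b k *
    ∫ τ in Set.Ioi (0 : ℝ), τ ^ (k * (m + 1)) * e τ| ≤ _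
  rw [hsum, hI, ← integral_sub hIint hPint, ← Real.norm_eq_abs]
  refine (norm_integral_le_of_norm_le ((hint (N * (m + 1))).const_mul D)
    ((ae_restrict_iff' measurableSet_Ioi).2 (Eventually.of_forall fun τ hτ => ?_))).trans_eq ?_
  · rw [← sub_mul, norm_mul, Real.norm_eq_abs, Real.norm_eq_abs, abs_of_pos (Real.exp_pos _),
      ← mul_assoc]
    exact mul_le_mul_of_nonneg_right (hbound τ hτ) (Real.exp_pos _).le
  · rw [integral_const_mul, integral_pow_mul_exp_neg_mul_pow _ _ hn]
    have : (-(((N * (m + 1) : ℕ) : ℝ) + 1) / ((m : ℝ) + 1)) = -(1 / ((m : ℝ) + 1)) - (N : ℝ) := by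
      push_cast
      field_simp
      ring
    rw [this]
    ring

/-! ### The factor `k p + 1` in the derivative of `τ h(τ^p)`. -/

/-- The operator `1 + p s d/ds` multiplies the `k`-th coefficient by `k p + 1`; at `s = τ^p` it
gives the derivative of `τ h(τ^p)`. -/
theorem AnalyticAt.eventually_hasSum_euler {h : ℝ → ℝ} (hh : AnalyticAt ℝ h 0) (p : ℝ) :
    ∀ᶠ s in nhds 0, HasSum (fun k : ℕ => iteratedDeriv k h 0 / (k.factorial : ℝ) *
      ((k : ℝ) * p + 1) * s ^ k) (h s + p * (s * deriv h s)) := by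
  obtain ⟨r, hr⟩ := hh.hasFPowerSeriesAt
  filter_upwards [Metric.eball_mem_nhds (0 : ℝ) hr.r_pos] with s hs
  have h1 := hr.hasSum hs
  rw [zero_add] at h1
  have h2 := (hr.hasSum_deriv_real hs).mul_left s
  have h3 : HasSum (fun n : ℕ => (n : ℝ) * (iteratedDeriv n h 0 / (n.factorial : ℝ)) * s ^ n)
      (s * deriv h s) := by
    rw [← hasSum_nat_add_iff' 1]
    simp only [Finset.range_one, Finset.sum_singleton, Nat.cast_zero, zero_mul, sub_zero]
    refine h2.congr_fun fun n => ?_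
    push_cast
    ring
  refine (h1.add (h3.mul_left p)).congr_fun fun n => ?_
  simp only [FormalMultilinearSeries.ofScalars_apply_eq, smul_eq_mul]
  ring

theorem AnalyticAt.isBigO_euler {h : ℝ → ℝ} (hh : AnalyticAt ℝ h 0) (p : ℝ) (N : ℕ) :
    (fun s => h s + p * (s * deriv h s) - ∑ k ∈ Finset.range N,
      iteratedDeriv k h 0 / (k.factorial : ℝ) * ((k : ℝ) * p + 1) * s ^ k)
      =O[nhds 0] fun s => s ^ N := by
  have h1 := (hh.hasTaylor N).add
    ((HasTaylor.const N p).mul ((HasTaylor.id N).mul (hh.hasTaylor_deriv N)))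
  refine IsBigO.congr_left h1 fun s => ?_
  rw [HasTaylor.eval_trunc]
  congr 1
  refine Finset.sum_congr rfl fun k _ => ?_
  congr 1
  rw [map_add, PowerSeries.coeff_C_mul, PowerSeries.coeff_mk]
  rcases k with _ | k
  · simp
  · rw [PowerSeries.coeff_succ_X_mul, PowerSeries.coeff_mk]
    push_cast
    ring

/-! ### Change of variables and the asymptotic expansion. -/

section
variable {m : ℕ} {σ : Fin m → ℝ}

/-- `x` as a function of `τ`, near `τ = 0`. -/
noncomputable def hyperParam (σ : Fin m → ℝ) (h : ℝ → ℝ) (τ : ℝ) : ℝ :=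
  ((m : ℝ) + 1) / hyperMu σ 1 ^ (1 / ((m : ℝ) + 1)) * (τ * h (τ ^ (m + 1)))

theorem hasDerivAt_hyperParam {h : ℝ → ℝ} {τ : ℝ} (hh : AnalyticAt ℝ h (τ ^ (m + 1))) :
    HasDerivAt (hyperParam σ h) (((m : ℝ) + 1) / hyperMu σ 1 ^ (1 / ((m : ℝ) + 1)) *
      (h (τ ^ (m + 1)) + ((m : ℝ) + 1) * (τ ^ (m + 1) * deriv h (τ ^ (m + 1))))) τ := by
  have h1 : HasDerivAt (fun τ => h (τ ^ (m + 1)))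
      (deriv h (τ ^ (m + 1)) * (((m + 1 : ℕ) : ℝ) * τ ^ m)) τ :=
    HasDerivAt.comp (h₂ := h) τ hh.differentiableAt.hasDerivAt (hasDerivAt_pow (m + 1) τ)
  convert! ((hasDerivAt_id τ).mul h1).const_mul _ using 2
  simp only [id]
  push_cast
  ring

/-- The properties of the local parametrisation `hyperParam`, near `τ = 0`. -/
theorem eventually_hyperParam (hm : 1 ≤ m) (hσ : ∀ j, -1 < σ j) {h : ℝ → ℝ}
    (hh : AnalyticAt ℝ h 0) (h0 : h 0 = 1)
    (hs : ∀ᶠ s in nhds 0, hyperSeries σ ∅ (s * h s ^ (m + 1) / hyperMu σ 1) = Real.exp (-s)) :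
    ∀ᶠ τ in nhds (0 : ℝ), AnalyticAt ℝ h (τ ^ (m + 1)) ∧
      HasSum (fun k : ℕ => iteratedDeriv k h 0 / (k.factorial : ℝ) *
        ((k : ℝ) * ((m : ℝ) + 1) + 1) * (τ ^ (m + 1)) ^ k)
        (h (τ ^ (m + 1)) + ((m : ℝ) + 1) * (τ ^ (m + 1) * deriv h (τ ^ (m + 1)))) ∧
      normHyperBessel σ (hyperParam σ h τ) = Real.exp (-τ ^ (m + 1)) ∧
      (0 < τ → hyperParam σ h τ ∈ Set.Ioo 0 (hyperBesselFirstZero σ)) := by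
  have hpow : Tendsto (fun τ : ℝ => τ ^ (m + 1)) (nhds 0) (nhds 0) := by
    simpa using (continuous_pow (M := ℝ) (m + 1)).tendsto 0
  have hμ := hyperMu_pos hσ (k := 1) le_rfl
  have hp : (0 : ℝ) < (m : ℝ) + 1 := by positivity
  have hc : 0 < ((m : ℝ) + 1) / hyperMu σ 1 ^ (1 / ((m : ℝ) + 1)) := by positivity
  have hj : ∀ᶠ τ in nhds (0 : ℝ), hyperParam σ h τ < hyperBesselFirstZero σ := by
    have hcont := (hasDerivAt_hyperParam (σ := σ) (h := h) (τ := 0) (by simpa using hh)).continuousAt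
    refine hcont.eventually (gt_mem_nhds ?_)
    simpa [hyperParam] using (isLeast_hyperBesselFirstZero hm hσ).1.1
  filter_upwards [hpow.eventually hh.eventually_analyticAt,
    hpow.eventually (hh.eventually_hasSum_euler ((m : ℝ) + 1)), hpow.eventually hs, hj,
    hpow.eventually (hh.continuousAt.eventually (lt_mem_nhds (by rw [h0]; exact one_pos)))]
    with τ h1 h2 h3 h4 h5
  refine ⟨h1, h2, ?_, fun hτ => ⟨mul_pos hc (mul_pos hτ h5), h4⟩⟩
  rw [normHyperBessel_eq, ← h3, hyperParam]
  congr 1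
  have hroot : (hyperMu σ 1 ^ (1 / ((m : ℝ) + 1))) ^ (m + 1) = hyperMu σ 1 := by
    have := Real.rpow_inv_natCast_pow hμ.le (Nat.succ_ne_zero m)
    push_cast at this
    rwa [one_div]
  rw [div_mul_eq_mul_div, div_right_comm, mul_div_cancel_left₀ _ hp.ne', div_pow, mul_pow, hroot]

theorem hyper_isHyperCoeff (hm : 1 ≤ m) (hσ : ∀ j, -1 < σ j) {h : ℝ → ℝ}
    (hh : AnalyticAt ℝ h 0) (h0 : h 0 = 1)
    (hs : ∀ᶠ s in nhds 0, hyperSeries σ ∅ (s * h s ^ (m + 1) / hyperMu σ 1) = Real.exp (-s)) :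
    IsHyperCoeff σ fun k => (-((m : ℝ) + 1)) ^ k * (iteratedDeriv k h 0 / (k.factorial : ℝ)) := by
  obtain ⟨ε, hε, H⟩ := Metric.eventually_nhds_iff.1 (eventually_hyperParam hm hσ hh h0 hs)
  have H' : ∀ τ ∈ Set.Ioo 0 ε, _ := fun τ hτ => H (y := τ) (by
    rw [Real.dist_0_eq_abs, abs_of_pos hτ.1]; exact hτ.2)
  refine ⟨ε, hε, fun τ hτ => ⟨_, (hasDerivAt_hyperParam (σ := σ) (H' τ hτ).1).congr_of_eventuallyEq ?_, ?_⟩⟩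
  -- `hyperX` agrees with the analytic parametrisation on an open interval around `τ`, so it has the
  -- same derivative there.
  · filter_upwards [isOpen_Ioo.mem_nhds hτ] with t ht
    obtain ⟨-, -, h3, h4⟩ := H' t ht
    exact hyperX_eq hm hσ ht.1.le (h4 ht.1) h3
  · refine ((H' τ hτ).2.1.mul_left _).congr_fun fun k => ?_
    have hp : ((m : ℝ) + 1) ≠ 0 := by positivity
    congr 1
    beta_reduce
    rw [neg_pow ((m : ℝ) + 1), ← pow_mul, mul_comm (m + 1) k]
    have : ((-1 : ℝ) ^ k) * (-1) ^ k = 1 := by rw [← mul_pow]; simp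
    field_simp
    rw [pow_two, this, one_mul]

/-- The moment integral produces `Γ(k + 1/p)`, and the factor `k p + 1 = p (k + 1/p)` raises it to
`Γ(k + 1/p + 1)`; the signs and the powers of `p` cancel. -/
theorem hyper_watson_term (hσ : ∀ j, -1 < σ j) {p : ℝ} (hp : p = (m : ℝ) + 1) {n : ℝ} (hn : 0 < n)
    (η : ℝ) (k : ℕ) :
    p / (n * hyperMu σ 1) ^ (1 / p) * ((-1) ^ k * ((-p) ^ k * η) / (n * p) ^ k *
      Real.Gamma ((k : ℝ) + 1 / p + 1)) =
    p / hyperMu σ 1 ^ (1 / p) * (η * ((k : ℝ) * p + 1) * ∫ τ in Set.Ioi (0 : ℝ),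
      τ ^ (k * (m + 1)) * Real.exp (-(n * τ ^ (m + 1)))) := by
  have hp0 : 0 < p := by rw [hp]; positivity
  have hμ := hyperMu_pos hσ (k := 1) le_rfl
  rw [integral_pow_mul_exp_neg_mul_pow _ _ hn]
  push_cast
  rw [← hp]
  have e1 : ((k : ℝ) * p + 1) / p = (k : ℝ) + 1 / p := by field_simp
  have e2 : -((k : ℝ) * p + 1) / p = -(k : ℝ) + -(1 / p) := by rw [neg_div, e1, neg_add]
  have hne : (k : ℝ) + 1 / p ≠ 0 := by positivity
  have e3 : (k : ℝ) * p + 1 = p * ((k : ℝ) + 1 / p) := by field_simp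
  rw [e1, e2, Real.Gamma_add_one hne, Real.rpow_add hn, Real.rpow_neg hn.le, Real.rpow_neg hn.le,
    Real.rpow_natCast, Real.mul_rpow hn.le hμ.le, e3, neg_pow p, mul_pow]
  have h1 : ((-1 : ℝ) ^ k) * (-1) ^ k = 1 := by rw [← mul_pow]; simp
  have h2 : n ^ (1 / p) ≠ 0 := (Real.rpow_pos_of_pos hn _).ne'
  have h3 : hyperMu σ 1 ^ (1 / p) ≠ 0 := (Real.rpow_pos_of_pos hμ _).ne'
  have h4 : (-1 : ℝ) ^ k * ((-1) ^ k * p ^ k * η) = p ^ k * η := by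
    rw [← mul_assoc, ← mul_assoc, h1, one_mul]
  rw [h4]
  generalize n ^ (1 / p) = u at *
  generalize hyperMu σ 1 ^ (1 / p) = v at *
  generalize (k : ℝ) + 1 / p = w at *
  field_simp

theorem hyperBesselIntegral_isBigO (hm : 1 ≤ m) (hσ : ∀ j, -1 < σ j) {p : ℝ}
    (hp : p = (m : ℝ) + 1) {h : ℝ → ℝ} (hh : AnalyticAt ℝ h 0) (h0 : h 0 = 1)
    (hs : ∀ᶠ s in nhds 0, hyperSeries σ ∅ (s * h s ^ (m + 1) / hyperMu σ 1) = Real.exp (-s))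
    (N : ℕ) :
    (fun n : ℝ => hyperBesselIntegral σ n - p / (n * hyperMu σ 1) ^ (1 / p) *
      ∑ k ∈ Finset.range N, (-1) ^ k * ((-p) ^ k * (iteratedDeriv k h 0 / (k.factorial : ℝ))) /
        (n * p) ^ k * Real.Gamma ((k : ℝ) + 1 / p + 1))
      =O[atTop] fun n : ℝ => n ^ (-(1 / p) - (N : ℝ)) := by
  set F := normHyperBessel σ with hF
  set j := hyperBesselFirstZero σ with hj
  have hFc : Continuous F := continuous_normHyperBessel hσ
  have hpow : Tendsto (fun τ : ℝ => τ ^ (m + 1)) (nhds 0) (nhds 0) := by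
    simpa using (continuous_pow (M := ℝ) (m + 1)).tendsto 0
  obtain ⟨C, hC⟩ := ((hh.isBigO_euler p N).comp_tendsto hpow).bound
  obtain ⟨ε, hε, H⟩ := Metric.eventually_nhds_iff.1
    ((eventually_hyperParam hm hσ hh h0 hs).and hC)
  -- Halving `ε` keeps the closed interval `[0, δ]` inside the neighbourhood where the
  -- parametrisation is controlled.
  set δ := ε / 2 with hδdef
  have hδ : 0 < δ := by positivity
  have H' : ∀ τ ∈ Set.Icc 0 δ, _ := fun τ hτ => H (y := τ) (by
    rw [Real.dist_0_eq_abs, abs_of_nonneg hτ.1]; linarith [hτ.2])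
  set E : ℝ → ℝ := fun τ => h (τ ^ (m + 1)) + p * (τ ^ (m + 1) * deriv h (τ ^ (m + 1))) with hE
  set b : ℕ → ℝ := fun k => iteratedDeriv k h 0 / (k.factorial : ℝ) * ((k : ℝ) * p + 1) with hb
  set c := p / hyperMu σ 1 ^ (1 / p) with hc
  set φ := hyperParam σ h with hφ
  have hφd : ∀ τ ∈ Set.Icc 0 δ, HasDerivAt φ (c * E τ) τ := fun τ hτ => by
    have := hasDerivAt_hyperParam (σ := σ) (H' τ hτ).1.1
    rwa [← hp] at this
  have hEc : ContinuousOn E (Set.Icc 0 δ) := by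
    intro τ hτ
    have ha := (H' τ hτ).1.1
    have hpc : ContinuousAt (fun τ : ℝ => τ ^ (m + 1)) τ := (continuous_pow (m + 1)).continuousAt
    have h1 : ContinuousAt (fun τ => h (τ ^ (m + 1))) τ :=
      ContinuousAt.comp' (g := h) (f := fun τ : ℝ => τ ^ (m + 1)) ha.continuousAt hpc
    have h2 : ContinuousAt (fun τ => deriv h (τ ^ (m + 1))) τ :=
      ContinuousAt.comp' (g := deriv h) (f := fun τ : ℝ => τ ^ (m + 1)) ha.deriv.continuousAt hpc
    exact (h1.add (continuousAt_const.mul (hpc.mul h2))).continuousWithinAt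
  have hbd : ∀ τ ∈ Set.Icc 0 δ,
      |E τ - ∑ k ∈ Finset.range N, b k * τ ^ (k * (m + 1))| ≤ C * τ ^ (N * (m + 1)) := by
    intro τ hτ
    have := (H' τ hτ).2
    simp only [Function.comp_apply, Real.norm_eq_abs, ← pow_mul, mul_comm (m + 1)] at this
    rwa [abs_of_nonneg (pow_nonneg hτ.1 (N * (m + 1)))] at this
  obtain ⟨C', hC'⟩ := watson_bound m N hδ hEc hbd
  have hδmem : δ ∈ Set.Icc 0 δ := ⟨hδ.le, le_rfl⟩
  have hx1 : φ δ ∈ Set.Ioo 0 j := (H' δ hδmem).1.2.2.2 hδ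
  have hφ0 : φ 0 = 0 := by simp [hφ, hyperParam]
  -- Substituting `x = φ(τ)` turns `F(x)^n` into `exp(-n τ^p)`.
  have hmain : ∀ n : ℝ, 0 < n → ∫ x in (0 : ℝ)..φ δ, F x ^ n =
      c * ∫ τ in (0 : ℝ)..δ, Real.exp (-(n * τ ^ (m + 1))) * E τ := by
    intro n hn
    have h1 := intervalIntegral.integral_comp_mul_deriv (a := 0) (b := δ) (f := φ)
      (f' := fun τ => c * E τ) (g := fun x => F x ^ n)
      (by rw [Set.uIcc_of_le hδ.le]; exact hφd)
      (by rw [Set.uIcc_of_le hδ.le]; exact continuousOn_const.mul hEc)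
      (hFc.rpow_const fun _ => Or.inr hn.le)
    rw [hφ0] at h1
    rw [← h1, ← intervalIntegral.integral_const_mul]
    refine intervalIntegral.integral_congr fun τ hτ => ?_
    rw [Set.uIcc_of_le hδ.le] at hτ
    have h2 : F (φ τ) = _ := (H' τ hτ).1.2.2.1
    simp only [Function.comp_apply]
    rw [h2, ← Real.exp_mul]
    ring_nf
  -- Beyond `φ δ` monotonicity gives `0 ≤ F ≤ F(φ δ) = exp(-δ^p)`, so the tail is exponentially
  -- small in `n`.
  have htail : ∀ n : ℝ, 0 < n →
      |∫ x in (φ δ)..j, F x ^ n| ≤ (j - φ δ) * Real.exp (-δ ^ (m + 1) * n) := by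
    intro n hn
    rw [← Real.norm_eq_abs, mul_comm, ← abs_of_pos (sub_pos.2 hx1.2)]
    refine intervalIntegral.norm_integral_le_of_norm_le_const fun x hx => ?_
    rw [Set.uIoc_of_le hx1.2.le] at hx
    have hx0 : 0 ≤ x := hx1.1.le.trans hx.1.le
    have hFx : 0 ≤ F x := by
      rcases hx.2.eq_or_lt with h' | h'
      · rw [h']; exact (isLeast_hyperBesselFirstZero hm hσ).1.2.ge
      · exact (normHyperBessel_pos hm hσ ⟨hx0, h'⟩).le
    have h2 : F (φ δ) = _ := (H' δ hδmem).1.2.2.1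
    rw [Real.norm_eq_abs, abs_of_nonneg (Real.rpow_nonneg hFx n), Real.exp_mul, ← h2]
    exact Real.rpow_le_rpow hFx ((strictAntiOn_normHyperBessel hm hσ).antitoneOn
      ⟨hx1.1.le, hx1.2.le⟩ ⟨hx0, hx.2⟩ hx.1.le) hn.le
  have hO1 : (fun n : ℝ => c * ((∫ τ in (0 : ℝ)..δ, Real.exp (-(n * τ ^ (m + 1))) * E τ) -
      ∑ k ∈ Finset.range N, b k * ∫ τ in Set.Ioi (0 : ℝ),
        τ ^ (k * (m + 1)) * Real.exp (-(n * τ ^ (m + 1)))))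
      =O[atTop] fun n : ℝ => n ^ (-(1 / p) - (N : ℝ)) := by
    refine IsBigO.const_mul_left (IsBigO.of_bound C' ?_) c
    filter_upwards [eventually_gt_atTop 0] with n hn
    rw [Real.norm_eq_abs, Real.norm_eq_abs, abs_of_pos (Real.rpow_pos_of_pos hn _)]
    have := hC' n hn
    rwa [← hp] at this
  have hO2 : (fun n : ℝ => ∫ x in (φ δ)..j, F x ^ n)
      =O[atTop] fun n : ℝ => n ^ (-(1 / p) - (N : ℝ)) := by
    refine IsBigO.trans (IsBigO.of_bound (j - φ δ) ?_)
      (isLittleO_exp_neg_mul_rpow_atTop (pow_pos hδ (m + 1)) _).isBigO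
    filter_upwards [eventually_gt_atTop 0] with n hn
    rw [Real.norm_eq_abs, Real.norm_eq_abs, abs_of_pos (Real.exp_pos _)]
    exact htail n hn
  refine (hO1.add hO2).congr' ?_ EventuallyEq.rfl
  filter_upwards [eventually_gt_atTop 0] with n hn
  have hFn : Continuous fun x => F x ^ n := hFc.rpow_const fun _ => Or.inr hn.le
  have hsplit : hyperBesselIntegral σ n =
      (∫ x in (0 : ℝ)..φ δ, F x ^ n) + ∫ x in (φ δ)..j, F x ^ n :=
    (intervalIntegral.integral_add_adjacent_intervals (hFn.intervalIntegrable _ _)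
      (hFn.intervalIntegrable _ _)).symm
  rw [hsplit, hmain n hn, Finset.mul_sum, mul_sub, Finset.mul_sum]
  rw [Finset.sum_congr rfl fun k _ => hyper_watson_term hσ hp hn _ k]
  ring

end

theorem theorem2 (m : ℕ) (hm : 1 ≤ m) (σ : Fin m → ℝ) (hσ : ∀ j, -1 < σ j)
    (p : ℝ) (hp : p = (m : ℝ) + 1) (γ : ℕ → ℝ) (hγ : ∀ k, γ k = hyperGamma σ k) :
    IsLeast {x : ℝ | 0 < x ∧ normHyperBessel σ x = 0} (hyperBesselFirstZero σ) ∧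
    ∃ A : ℕ → ℝ, IsHyperCoeff σ A ∧
      A 0 = 1 ∧
      A 1 = 1 / 2 * (1 - γ 2) ∧
      A 2 = 1 / 24 * (p + 3 - 6 * (p + 1) * γ 2 + 3 * (3 * p + 1) * γ 2 ^ 2
        - 4 * p * γ 2 * γ 3) ∧
      A 3 = 1 / 48 * (p + 1 - (p + 1) * (4 * p + 3) * γ 2
        + 3 * (2 * p + 1) * (3 * p + 1) * γ 2 ^ 2 - 4 * p * (2 * p + 1) * γ 2 * γ 3
        - γ 2 * ((1 + 9 * p + 20 * p ^ 2) * γ 2 ^ 2 - 4 * p * (4 * p + 1) * γ 2 * γ 3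
          + 2 * p ^ 2 * γ 3 * γ 4)) ∧
      A 4 = 1 / 5760 * (15 + 30 * p + 5 * p ^ 2 - 2 * p ^ 3
        - 60 * (p + 1) ^ 2 * (2 * p + 1) * γ 2
        + 10 * (3 + 13 * p + 14 * p ^ 2) * γ 2 * (3 * (3 * p + 1) * γ 2 - 4 * p * γ 3)
        - 60 * (3 * p + 1) * γ 2 * ((1 + 9 * p + 20 * p ^ 2) * γ 2 ^ 2
          - 4 * p * (4 * p + 1) * γ 2 * γ 3 + 2 * p ^ 2 * γ 3 * γ 4)
        + γ 2 * (15 * (1 + 18 * p + 107 * p ^ 2 + 210 * p ^ 3) * γ 2 ^ 3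
          - 120 * p * (1 + 11 * p + 30 * p ^ 2) * γ 2 ^ 2 * γ 3
          + 40 * p ^ 2 * (5 * p + 1) * γ 2 * γ 3 * (2 * γ 3 + 3 * γ 4)
          - 48 * p ^ 3 * γ 3 * γ 4 * γ 5)) ∧
      ∀ N : ℕ,
        (fun n : ℝ => hyperBesselIntegral σ n
          - p / (n * hyperMu σ 1) ^ (1 / p) *
            ∑ k ∈ Finset.range N,
              (-1) ^ k * A k / (n * p) ^ k * Real.Gamma ((k : ℝ) + 1 / p + 1))
        =O[atTop] (fun n : ℝ => n ^ (-(1 / p) - (N : ℝ))) := by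
  refine ⟨isLeast_hyperBesselFirstZero hm hσ, ?_⟩
  obtain ⟨h, hh, h0, hs, hA⟩ := exists_hyper_local_inverse hσ hp hγ
  obtain ⟨A0, A1, A2, A3, A4⟩ := hA _ fun _ => rfl
  refine ⟨_, ?_, A0, A1, A2, A3, A4, fun N => hyperBesselIntegral_isBigO hm hσ hp hh h0 hs N⟩
  rw [hp]
  exact hyper_isHyperCoeff hm hσ hh h0 hs
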